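/- Let $\mathbb{Q}_\mathbb{R}$ be the reduced biquaternions $\alpha_0+\alpha_1 i+\alpha_2 j+\alpha_3 k$ ($\alpha_t\in\mathbb{R}$, $i^2=k^2=-1$, $j^2=1$, $ij=ji=k$, $jk=kj=i$, $ki=ik=-j$), $|\alpha|^2=\sum_t\alpha_t^2$, and let $\|\cdot\|_F$, $\|\cdot\|_2$ denote the Frobenius and the spectral norm. For $M=M_0+M_1i+M_2j+M_3k$ over $\mathbb{Q}_\mathbb{R}$ with $M_t$ real, put $M_c^R=[M_0^T,M_1^T,M_2^T,M_3^T]^T$. Let $A\in\mathbb{Q}_\mathbb{R}^{m\times n}$, $B\in\mathbb{Q}_\mathbb{R}^{m\times d}$, $C\in\mathbb{Q}_\mathbb{R}^{p\times n}$, $D\in\mathbb{Q}_\mathbb{R}^{p\times d}$, with $m\ge n+d$ and $C_c^R$ of full row rank $4p$ (so $4p\le n$). A *real RBTLSE solution* for the data $(A,B,C,D)$ is an $X\in\mathbb{R}^{n\times d}$ for which some $\bar E,\bar F$ over $\mathbb{Q}_\mathbb{R}$ exist such that $(X,\bar E,\bar F)$ attains $$\min_{X,\bar E,\bar F}\|[\bar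 E,\bar F]\|_F\quad\text{subject to}\quad (A+\bar E)X=B+\bar F,\ \ CX=D,$$ the minimum being over real $X\in\mathbb{R}^{n\times d}$ and $\bar E\in\mathbb{Q}_\mathbb{R}^{m\times n}$, $\bar F\in\mathbb{Q}_\mathbb{R}^{m\times d}$. Put $\hat P=[A_c^R,B_c^R]$, $\hat S=[C_c^R,D_c^R]$. Let $\hat S^T=[\hat Q_1,\hat Q_2]\begin{bmatrix}\hat R\\0\end{bmatrix}$ be a QR factorization ($[\hat Q_1,\hat Q_2]$ orthogonal, $\hat Q_1$ with $4p$ columns, $\hat R\in\mathbb{R}^{4p\times 4p}$ upper triangular), and let $\hat P\hat Q_2=\hat U\hat\Sigma\hat V^T$ be a thin SVD with $\hat\Sigma=\mathrm{diag}(\hat\sigma_1,\dots,\hat\sigma_{n-4p+d})$, $$\hat\sigma_1\ge\dots\ge\hat\sigma_{n-4p}>\hat\sigma_{n-4p+1}\ge\dots\ge\hat\sigma_{n-4p+d}>0$$ (the strict inequality in the middle being void if $n=4p$). Partition $\hat U=[\hat U_1,\hat U_2]$, $\hat\Sigma=\mathrm{diag}(\hat\Sigma_1,\hat\Sigma_2)$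 and $\check V=\hat Q_2\hat V=[\check V_1,\check V_2]=\begin{bmatrix}\check V_{11}&\check V_{12}\\ \check V_{21}&\check V_{22}\end{bmatrix}$ with column blocks of sizes $n-4p$, $d$ and row blocks of $\check V$ of sizes $n$, $d$, and assume that $\check V_{22}$ is invertible. Let $\hat S=\hat U_s\hat S_s\hat V_s^T$ be a skinny SVD (with $\hat S_s$ of size $4p\times 4p$), $\hat S^\dagger$ the Moore–Penrose inverse of $\hat S$, and define $$Q_r=\begin{bmatrix}-(\hat P\hat S^\dagger)^T\\ I_{4m}\end{bmatrix},\quad S_r=\begin{bmatrix}\hat S_s&0\\0&\hat\Sigma_1\end{bmatrix},\quad [\hat V_s,\check V_1]=\begin{bmatrix}W_{1r}\\W_{2r}\end{bmatrix}\ (W_{1r}\in\mathbb{R}^{n\times n}),\quad \Pi_{(d,n)}=\sum_{i=1}^d\sum_{j=1}^nE_{ij}\otimes E_{ij}^T,$$ where $E_{ij}\in\mathbb{R}^{d\times n}$ has a single nonzero entry, a $1$ at position $(i,j)$, and $$H_r=(\check V_{22}^{-T}\otimes W_{1r}^{-T})\,\Pi_{(d,n)},$$ $$G_r=\left(S_r^2\otimes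 I_d-\begin{bmatrix}0_{4p}&0\\0&I_{n-4p}\end{bmatrix}\otimes(\hat\Sigma_2^T\hat\Sigma_2)\right)^{-1}\left[I_n\otimes\hat\Sigma_2^T,\ S_r\otimes I_d\right],$$ $$Z_r=\mathrm{diag}\left(\begin{bmatrix}0_{4p}&0\\0&I_{n-4p}\end{bmatrix}\otimes(\hat U_2^TQ_r^T),\ \begin{bmatrix}I_{4p}&0\\-\hat U_1^T(\hat P\hat S^\dagger)\hat U_s&I_{n-4p}\end{bmatrix}\otimes I_d\right).$$ Let $J=\begin{bmatrix}C\\A\end{bmatrix}$, $K=\begin{bmatrix}D\\B\end{bmatrix}$, $J_r=\begin{bmatrix}C_c^R\\A_c^R\end{bmatrix}$, $K_r=\begin{bmatrix}D_c^R\\B_c^R\end{bmatrix}$, and for perturbations $\Delta A,\Delta B,\Delta C,\Delta D$ of the data let $\Delta J=\begin{bmatrix}\Delta C\\ \Delta A\end{bmatrix}$, $\Delta K=\begin{bmatrix}\Delta D\\ \Delta B\end{bmatrix}$. Let $X_{RT}$ be the real RBTLSE solution for $(A,B,C,D)$ and assume $X_{RT}\ne0$. Then for all perturbations with $\|[\Delta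 J,\Delta K]\|_F\le\delta\|[J,K]\|_F$, where $\delta>0$ is some constant depending on the data, the perturbed data $(A+\Delta A,B+\Delta B,C+\Delta C,D+\Delta D)$ have exactly one real RBTLSE solution $\widehat X_{RT}$; and with $\Delta X_{RT}=X_{RT}-\widehat X_{RT}$, the supremum below is finite for all small $\epsilon>0$, the limit exists, and the relative normwise condition number is $$\lim_{\epsilon\to0^+}\sup\left\{\frac{\|\Delta X_{RT}\|_F}{\epsilon\|X_{RT}\|_F}\ :\ \|[\Delta J,\Delta K]\|_F\le\epsilon\|[J,K]\|_F\right\}=\|H_rG_rZ_r\|_2\,\frac{\|[J_r,K_r]\|_F}{\|X_{RT}\|_F}.$$ -/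

import Mathlib

open Matrix Filter Topology
open scoped Kronecker

/-- Reduced biquaternions `re + imI i + imJ j + imK k`, with
`i² = k² = -1`, `j² = 1`, `ij = ji = k`, `jk = kj = i`, `ki = ik = -j`. -/
@[ext]
structure RBQ where
  re : ℝ
  imI : ℝ
  imJ : ℝ
  imK : ℝ

namespace RBQ

instance : Zero RBQ := ⟨⟨0, 0, 0, 0⟩⟩
instance : One RBQ := ⟨⟨1, 0, 0, 0⟩⟩
instance : Add RBQ :=
  ⟨fun a b => ⟨a.re + b.re, a.imI + b.imI, a.imJ + b.imJ, a.imK + b.imK⟩⟩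
instance : Neg RBQ := ⟨fun a => ⟨-a.re, -a.imI, -a.imJ, -a.imK⟩⟩
instance : Mul RBQ :=
  ⟨fun a b =>
    ⟨a.re * b.re - a.imI * b.imI + a.imJ * b.imJ - a.imK * b.imK,
     a.re * b.imI + a.imI * b.re + a.imJ * b.imK + a.imK * b.imJ,
     a.re * b.imJ - a.imI * b.imK + a.imJ * b.re - a.imK * b.imI,
     a.re * b.imK + a.imI * b.imJ + a.imJ * b.imI + a.imK * b.re⟩⟩

@[simp] theorem zero_re : (0 : RBQ).re = 0 := rfl
@[simp] theorem zero_imI : (0 : RBQ).imI = 0 := rfl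
@[simp] theorem zero_imJ : (0 : RBQ).imJ = 0 := rfl
@[simp] theorem zero_imK : (0 : RBQ).imK = 0 := rfl
@[simp] theorem one_re : (1 : RBQ).re = 1 := rfl
@[simp] theorem one_imI : (1 : RBQ).imI = 0 := rfl
@[simp] theorem one_imJ : (1 : RBQ).imJ = 0 := rfl
@[simp] theorem one_imK : (1 : RBQ).imK = 0 := rfl
@[simp] theorem add_re (a b : RBQ) : (a + b).re = a.re + b.re := rfl
@[simp] theorem add_imI (a b : RBQ) : (a + b).imI = a.imI + b.imI := rfl
@[simp] theorem add_imJ (a b : RBQ) : (a + b).imJ = a.imJ + b.imJ := rfl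
@[simp] theorem add_imK (a b : RBQ) : (a + b).imK = a.imK + b.imK := rfl
@[simp] theorem neg_re (a : RBQ) : (-a).re = -a.re := rfl
@[simp] theorem neg_imI (a : RBQ) : (-a).imI = -a.imI := rfl
@[simp] theorem neg_imJ (a : RBQ) : (-a).imJ = -a.imJ := rfl
@[simp] theorem neg_imK (a : RBQ) : (-a).imK = -a.imK := rfl
@[simp] theorem mul_re (a b : RBQ) :
    (a * b).re = a.re * b.re - a.imI * b.imI + a.imJ * b.imJ - a.imK * b.imK := rfl
@[simp] theorem mul_imI (a b : RBQ) :
    (a * b).imI = a.re * b.imI + a.imI * b.re + a.imJ * b.imK + a.imK * b.imJ := rfl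
@[simp] theorem mul_imJ (a b : RBQ) :
    (a * b).imJ = a.re * b.imJ - a.imI * b.imK + a.imJ * b.re - a.imK * b.imI := rfl
@[simp] theorem mul_imK (a b : RBQ) :
    (a * b).imK = a.re * b.imK + a.imI * b.imJ + a.imJ * b.imI + a.imK * b.re := rfl

noncomputable instance : CommRing RBQ where
  add_assoc a b c := by ext <;> simp <;> ring
  zero_add a := by ext <;> simp
  add_zero a := by ext <;> simp
  add_comm a b := by ext <;> simp <;> ring
  neg_add_cancel a := by ext <;> simp
  mul_assoc a b c := by ext <;> simp <;> ring
  one_mul a := by ext <;> simp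
  mul_one a := by ext <;> simp
  left_distrib a b c := by ext <;> simp <;> ring
  right_distrib a b c := by ext <;> simp <;> ring
  zero_mul a := by ext <;> simp
  mul_zero a := by ext <;> simp
  mul_comm a b := by ext <;> simp <;> ring
  nsmul := nsmulRec
  zsmul := zsmulRec

noncomputable instance : Norm RBQ :=
  ⟨fun a => Real.sqrt (a.re ^ 2 + a.imI ^ 2 + a.imJ ^ 2 + a.imK ^ 2)⟩

/-- A real number as a reduced biquaternion. -/
def ofReal (x : ℝ) : RBQ := ⟨x, 0, 0, 0⟩

/-- The four real components, in the order `1, i, j, k`. -/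
def coord (t : Fin 4) (a : RBQ) : ℝ := ![a.re, a.imI, a.imJ, a.imK] t

end RBQ

namespace RBTLSE

/-- Frobenius norm of a reduced biquaternion matrix. -/
noncomputable def rbFrob {ι κ : Type*} [Fintype ι] [Fintype κ] (P : Matrix ι κ RBQ) : ℝ :=
  Real.sqrt (∑ i, ∑ j, ‖P i j‖ ^ 2)

open scoped Matrix.Norms.Frobenius in
/-- Frobenius norm of a real matrix. -/
noncomputable def frob {ι κ : Type*} [Fintype ι] [Fintype κ] (M : Matrix ι κ ℝ) : ℝ := ‖M‖

open scoped Matrix.Norms.L2Operator in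
/-- Spectral norm of a real matrix. -/
noncomputable def specNorm {ι κ : Type*} [Fintype ι] [Fintype κ] [DecidableEq κ]
    (M : Matrix ι κ ℝ) : ℝ := ‖M‖

/-- For `P = P₀ + P₁ i + P₂ j + P₃ k`, the real `4m × n` matrix `[P₀ᵀ, P₁ᵀ, P₂ᵀ, P₃ᵀ]ᵀ`
(row `t * m + i` is row `i` of `P_t`). -/
def realCol {m n : ℕ} (P : Matrix (Fin m) (Fin n) RBQ) : Matrix (Fin (4 * m)) (Fin n) ℝ :=
  Matrix.of fun r c => RBQ.coord (finProdFinEquiv.symm r).1 (P (finProdFinEquiv.symm r).2 c)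

/-- `(A + E) X = B + F`, `C X = D`, with `X` real. -/
def Feasible {m n d p : ℕ}
    (A : Matrix (Fin m) (Fin n) RBQ) (B : Matrix (Fin m) (Fin d) RBQ)
    (C : Matrix (Fin p) (Fin n) RBQ) (D : Matrix (Fin p) (Fin d) RBQ)
    (X : Matrix (Fin n) (Fin d) ℝ)
    (E : Matrix (Fin m) (Fin n) RBQ) (F : Matrix (Fin m) (Fin d) RBQ) : Prop :=
  (A + E) * X.map RBQ.ofReal = B + F ∧ C * X.map RBQ.ofReal = D

/-- `X` is a real solution of the problem of minimizing `‖[E, F]‖_F` over real `X` and reduced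
biquaternion `E`, `F` subject to `(A + E) X = B + F`, `C X = D`. -/
def IsRealSolution {m n d p : ℕ}
    (A : Matrix (Fin m) (Fin n) RBQ) (B : Matrix (Fin m) (Fin d) RBQ)
    (C : Matrix (Fin p) (Fin n) RBQ) (D : Matrix (Fin p) (Fin d) RBQ)
    (X : Matrix (Fin n) (Fin d) ℝ) : Prop :=
  ∃ (E : Matrix (Fin m) (Fin n) RBQ) (F : Matrix (Fin m) (Fin d) RBQ),
    Feasible A B C D X E F ∧
    ∀ (X' : Matrix (Fin n) (Fin d) ℝ)
      (E' : Matrix (Fin m) (Fin n) RBQ) (F' : Matrix (Fin m) (Fin d) RBQ),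
      Feasible A B C D X' E' F' → rbFrob (fromCols E F) ≤ rbFrob (fromCols E' F')

/-- `‖[J, K]‖_F` with `J = [C; A]`, `K = [D; B]`. -/
noncomputable def dataNorm {m n d p : ℕ}
    (A : Matrix (Fin m) (Fin n) RBQ) (B : Matrix (Fin m) (Fin d) RBQ)
    (C : Matrix (Fin p) (Fin n) RBQ) (D : Matrix (Fin p) (Fin d) RBQ) : ℝ :=
  rbFrob (fromCols (fromRows C A) (fromRows D B))

/-- The problem is well posed near the data: after every sufficiently small perturbation of
the data there is exactly one real solution. -/
def LocallyUniquelySolvable {m n d p : ℕ}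
    (A : Matrix (Fin m) (Fin n) RBQ) (B : Matrix (Fin m) (Fin d) RBQ)
    (C : Matrix (Fin p) (Fin n) RBQ) (D : Matrix (Fin p) (Fin d) RBQ) : Prop :=
  ∃ δ : ℝ, 0 < δ ∧
    ∀ (ΔA : Matrix (Fin m) (Fin n) RBQ) (ΔB : Matrix (Fin m) (Fin d) RBQ)
      (ΔC : Matrix (Fin p) (Fin n) RBQ) (ΔD : Matrix (Fin p) (Fin d) RBQ),
      dataNorm ΔA ΔB ΔC ΔD ≤ δ * dataNorm A B C D →
      ∃! X : Matrix (Fin n) (Fin d) ℝ, IsRealSolution (A + ΔA) (B + ΔB) (C + ΔC) (D + ΔD) X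

/-- The relative errors, divided by `ε`, of the real solutions of the perturbed problems with
relative data perturbation at most `ε`. -/
def relErrors {m n d p : ℕ}
    (A : Matrix (Fin m) (Fin n) RBQ) (B : Matrix (Fin m) (Fin d) RBQ)
    (C : Matrix (Fin p) (Fin n) RBQ) (D : Matrix (Fin p) (Fin d) RBQ)
    (X : Matrix (Fin n) (Fin d) ℝ) (ε : ℝ) : Set ℝ :=
  {r | ∃ (ΔA : Matrix (Fin m) (Fin n) RBQ) (ΔB : Matrix (Fin m) (Fin d) RBQ)
      (ΔC : Matrix (Fin p) (Fin n) RBQ) (ΔD : Matrix (Fin p) (Fin d) RBQ)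
      (X' : Matrix (Fin n) (Fin d) ℝ),
      dataNorm ΔA ΔB ΔC ΔD ≤ ε * dataNorm A B C D ∧
      IsRealSolution (A + ΔA) (B + ΔB) (C + ΔC) (D + ΔD) X' ∧
      r = frob (X - X') / (ε * frob X)}

/-- `k` is the relative normwise condition number of the solution `X`: the supremum of
`relErrors` is finite for small `ε > 0` and tends to `k` as `ε → 0⁺`. -/
def HasRelCondNumber {m n d p : ℕ}
    (A : Matrix (Fin m) (Fin n) RBQ) (B : Matrix (Fin m) (Fin d) RBQ)
    (C : Matrix (Fin p) (Fin n) RBQ) (D : Matrix (Fin p) (Fin d) RBQ)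
    (X : Matrix (Fin n) (Fin d) ℝ) (k : ℝ) : Prop :=
  ∃ s : ℝ → ℝ, (∀ᶠ ε in 𝓝[>] (0 : ℝ), IsLUB (relErrors A B C D X ε) (s ε)) ∧
    Tendsto s (𝓝[>] (0 : ℝ)) (𝓝 k)

/-- `M = U diag(σ) Vᵀ` is a thin (skinny) singular value decomposition. -/
structure IsThinSVD {ι κ : Type*} [Fintype ι] [Fintype κ] {r : ℕ} (M : Matrix ι κ ℝ)
    (U : Matrix ι (Fin r) ℝ) (σ : Fin r → ℝ) (V : Matrix κ (Fin r) ℝ) : Prop where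
  left_orthonormal : Uᵀ * U = 1
  right_orthonormal : Vᵀ * V = 1
  antitone : Antitone σ
  nonneg : ∀ i, 0 ≤ σ i
  eq : M = U * diagonal σ * Vᵀ

/-- `Y` is the Moore–Penrose inverse of `M`. -/
structure IsMoorePenrose {ι κ : Type*} [Fintype ι] [Fintype κ]
    (M : Matrix ι κ ℝ) (Y : Matrix κ ι ℝ) : Prop where
  mul_mul : M * Y * M = M
  inv_mul_inv : Y * M * Y = Y
  left_symm : (M * Y)ᵀ = M * Y
  right_symm : (Y * M)ᵀ = Y * M

/-- `Π_(d,n) = ∑ᵢ ∑ⱼ Eᵢⱼ ⊗ Eᵢⱼᵀ`. -/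
def permMatrix (d n : ℕ) : Matrix (Fin d × Fin n) (Fin n × Fin d) ℝ :=
  ∑ i : Fin d, ∑ j : Fin n, Matrix.single i j (1 : ℝ) ⊗ₖ (Matrix.single i j (1 : ℝ))ᵀ

/-- The first `a` columns. -/
def leftCols {ι : Type*} {a b : ℕ} (M : Matrix ι (Fin (a + b)) ℝ) : Matrix ι (Fin a) ℝ :=
  M.submatrix id (Fin.castAdd b)

/-- The last `b` columns. -/
def rightCols {ι : Type*} {a b : ℕ} (M : Matrix ι (Fin (a + b)) ℝ) : Matrix ι (Fin b) ℝ :=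
  M.submatrix id (Fin.natAdd a)

/-- Blocks of sizes `a` and `b` put next to each other to give size `n = a + b`. -/
def blockEquiv {a b n : ℕ} (h : n = a + b) : Fin a ⊕ Fin b ≃ Fin n :=
  finSumFinEquiv.trans (finCongr h.symm)

/-- The `n × n` matrix with the given blocks, where `n = a + b`. -/
def block {a b n : ℕ} (h : n = a + b)
    (M₁₁ : Matrix (Fin a) (Fin a) ℝ) (M₁₂ : Matrix (Fin a) (Fin b) ℝ)
    (M₂₁ : Matrix (Fin b) (Fin a) ℝ) (M₂₂ : Matrix (Fin b) (Fin b) ℝ) :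
    Matrix (Fin n) (Fin n) ℝ :=
  reindex (blockEquiv h) (blockEquiv h) (fromBlocks M₁₁ M₁₂ M₂₁ M₂₂)

/-- `[-(P S†)ᵀ; I]`, with `Y` in the role of `S†`. -/
def Qr {μ ν κ : Type*} [Fintype κ] [DecidableEq μ]
    (P : Matrix μ κ ℝ) (Y : Matrix κ ν ℝ) : Matrix (ν ⊕ μ) μ ℝ :=
  fromRows (-(P * Y)ᵀ) 1

/-- The upper `n × n` part of `W = [V_s, V̌₁]`, where `n = a + b`. -/
def W1 {a b n d : ℕ} (h : n = a + b) (Vs : Matrix (Fin n ⊕ Fin d) (Fin a) ℝ)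
    (V1 : Matrix (Fin n ⊕ Fin d) (Fin b) ℝ) : Matrix (Fin n) (Fin n) ℝ :=
  (fromCols Vs V1).submatrix Sum.inl (blockEquiv h).symm

/-- `H = (V₂₂⁻ᵀ ⊗ W₁⁻ᵀ) Π_(d,n)`. -/
noncomputable def Hr {n d : ℕ} (V22 : Matrix (Fin d) (Fin d) ℝ) (W : Matrix (Fin n) (Fin n) ℝ) :
    Matrix (Fin d × Fin n) (Fin n × Fin d) ℝ :=
  ((V22⁻¹)ᵀ ⊗ₖ (W⁻¹)ᵀ) * permMatrix d n

/-- `G = (S² ⊗ I_d - diag(0_a, I_b) ⊗ (Σ₂ᵀ Σ₂))⁻¹ [I_n ⊗ Σ₂ᵀ, S ⊗ I_d]`. -/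
noncomputable def Gr {a b n d : ℕ} (h : n = a + b) (S : Matrix (Fin n) (Fin n) ℝ)
    (Sig2 : Matrix (Fin d) (Fin d) ℝ) :
    Matrix (Fin n × Fin d) ((Fin n × Fin d) ⊕ (Fin n × Fin d)) ℝ :=
  ((S ^ 2) ⊗ₖ (1 : Matrix (Fin d) (Fin d) ℝ) - (block h 0 0 0 1) ⊗ₖ (Sig2ᵀ * Sig2))⁻¹ *
    fromCols ((1 : Matrix (Fin n) (Fin n) ℝ) ⊗ₖ Sig2ᵀ) (S ⊗ₖ (1 : Matrix (Fin d) (Fin d) ℝ))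

/-- `Z = diag(diag(0_a, I_b) ⊗ (U₂ᵀ Qᵀ), [I_a, 0; -U₁ᵀ (P S†) U_s, I_b] ⊗ I_d)`,
with `Y` in the role of `S†`. -/
def Zr {a b n d : ℕ} {μ ν κ : Type*} [Fintype μ] [DecidableEq μ] [Fintype ν] [Fintype κ]
    (h : n = a + b) (P : Matrix μ κ ℝ) (Y : Matrix κ ν ℝ) (Us : Matrix ν (Fin a) ℝ)
    (U1 : Matrix μ (Fin b) ℝ) (U2 : Matrix μ (Fin d) ℝ) :
    Matrix ((Fin n × Fin d) ⊕ (Fin n × Fin d)) ((Fin n × (ν ⊕ μ)) ⊕ (Fin n × Fin d)) ℝ :=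
  fromBlocks
    ((block h 0 0 0 1) ⊗ₖ (U2ᵀ * (Qr P Y)ᵀ)) 0
    0 ((block h 1 0 (-(U1ᵀ * (P * Y) * Us)) 1) ⊗ₖ (1 : Matrix (Fin d) (Fin d) ℝ))

end RBTLSE

/-!
Stacking real components turns the problem into a real total least squares problem for `P`, `S`.
The optimal `E` for a given `X` is `-P` times the orthogonal projection onto the range of
`[X; -I]`, so that one minimizes the trace of `PᵀP` over the subspaces `range [X; -I]` of the
kernel of `S`. An `X` for which this subspace is invariant under the compression of `PᵀP` to the
kernel, with the eigenvalues on it below those on its complement, is the unique minimizer.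

Together with a basis of the complement, such an `X` is the zero of a polynomial system whose
linearization is injective because of the gap between the singular values. Hence the implicit
function theorem yields a smooth family of zeros for nearby data, and since the order of the
eigenvalues is an open condition, these are the unique solutions. The derivative of the family
solves a Sylvester equation with the matrix inverted in `G`. In vectorized form it is `H G Z`
after a coisometry, so its operator norm is the spectral norm of `H G Z`.
-/

namespace RBTLSE

/-! ### Reduction to a real problem -/

section Reduction

variable {m n d p : ℕ}

theorem coord_add (t : Fin 4) (a b : RBQ) :
    RBQ.coord t (a + b) = RBQ.coord t a + RBQ.coord t b := by
  fin_cases t <;> rfl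

theorem coord_sum {ι : Type*} (t : Fin 4) (s : Finset ι) (f : ι → RBQ) :
    RBQ.coord t (∑ i ∈ s, f i) = ∑ i ∈ s, RBQ.coord t (f i) :=
  map_sum (AddMonoidHom.mk' (RBQ.coord t) (coord_add t)) f s

theorem coord_mul_ofReal (t : Fin 4) (a : RBQ) (x : ℝ) :
    RBQ.coord t (a * RBQ.ofReal x) = RBQ.coord t a * x := by
  fin_cases t <;> simp [RBQ.coord, RBQ.ofReal]

theorem norm_sq_eq_sum_coord_sq (a : RBQ) : ‖a‖ ^ 2 = ∑ t, RBQ.coord t a ^ 2 := by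
  change Real.sqrt _ ^ 2 = _
  rw [Real.sq_sqrt (by positivity), Fin.sum_univ_four]
  rfl

theorem realCol_add (P Q : Matrix (Fin m) (Fin n) RBQ) :
    realCol (P + Q) = realCol P + realCol Q := by
  ext r c
  exact coord_add _ _ _

theorem realCol_mul_map_ofReal (P : Matrix (Fin m) (Fin n) RBQ) (X : Matrix (Fin n) (Fin d) ℝ) :
    realCol (P * X.map RBQ.ofReal) = realCol P * X := by
  ext r c
  simp [realCol, mul_apply, coord_sum, coord_mul_ofReal]

/-- The inverse of `realCol`: the reduced biquaternion matrix with the given stack of real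
components. -/
def ofRealCol (M : Matrix (Fin (4 * m)) (Fin n) ℝ) : Matrix (Fin m) (Fin n) RBQ :=
  Matrix.of fun i c => ⟨M (finProdFinEquiv (0, i)) c, M (finProdFinEquiv (1, i)) c,
    M (finProdFinEquiv (2, i)) c, M (finProdFinEquiv (3, i)) c⟩

theorem realCol_ofRealCol (M : Matrix (Fin (4 * m)) (Fin n) ℝ) : realCol (ofRealCol M) = M := by
  ext r c
  obtain ⟨⟨t, i⟩, rfl⟩ := finProdFinEquiv.surjective r
  simp only [realCol, of_apply, Equiv.symm_apply_apply, ofRealCol]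
  fin_cases t <;> rfl

theorem ofRealCol_realCol (P : Matrix (Fin m) (Fin n) RBQ) : ofRealCol (realCol P) = P := by
  ext i c <;>
    simp only [realCol, ofRealCol, of_apply, Equiv.symm_apply_apply, RBQ.coord] <;> rfl

theorem realCol_injective :
    Function.Injective (realCol : Matrix (Fin m) (Fin n) RBQ → Matrix (Fin (4 * m)) (Fin n) ℝ) :=
  Function.LeftInverse.injective ofRealCol_realCol

theorem frob_eq_sqrt {ι κ : Type*} [Fintype ι] [Fintype κ] (M : Matrix ι κ ℝ) :
    frob M = Real.sqrt (∑ i, ∑ j, M i j ^ 2) := by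
  simp [frob, frobenius_norm_def, Real.sqrt_eq_rpow]

theorem sum_norm_sq_eq_sum_realCol_sq (P : Matrix (Fin m) (Fin n) RBQ) :
    ∑ i, ∑ j, ‖P i j‖ ^ 2 = ∑ r, ∑ j, realCol P r j ^ 2 := by
  rw [← (finProdFinEquiv (m := 4) (n := m)).sum_comp fun r => ∑ j, realCol P r j ^ 2,
    Fintype.sum_prod_type, eq_comm, Finset.sum_comm]
  simp only [norm_sq_eq_sum_coord_sq, realCol, of_apply, Equiv.symm_apply_apply]
  exact Finset.sum_congr rfl fun i _ => Finset.sum_comm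

theorem rbFrob_fromCols (E : Matrix (Fin m) (Fin n) RBQ) (F : Matrix (Fin m) (Fin d) RBQ) :
    rbFrob (fromCols E F) = frob (fromCols (realCol E) (realCol F)) := by
  simp only [rbFrob, frob_eq_sqrt, Fintype.sum_sum_type, fromCols_apply_inl, fromCols_apply_inr,
    Finset.sum_add_distrib, sum_norm_sq_eq_sum_realCol_sq]

/-- The real data matrix `[S; P]` with `S = [C, D]` and `P = [A, B]`, in stacked components. -/
def realData (A : Matrix (Fin m) (Fin n) RBQ) (B : Matrix (Fin m) (Fin d) RBQ)
    (C : Matrix (Fin p) (Fin n) RBQ) (D : Matrix (Fin p) (Fin d) RBQ) :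
    Matrix (Fin (4 * p) ⊕ Fin (4 * m)) (Fin n ⊕ Fin d) ℝ :=
  fromRows (fromCols (realCol C) (realCol D)) (fromCols (realCol A) (realCol B))

theorem dataNorm_eq_frob_realData (A : Matrix (Fin m) (Fin n) RBQ) (B : Matrix (Fin m) (Fin d) RBQ)
    (C : Matrix (Fin p) (Fin n) RBQ) (D : Matrix (Fin p) (Fin d) RBQ) :
    dataNorm A B C D = frob (realData A B C D) := by
  simp only [dataNorm, rbFrob, frob_eq_sqrt, realData, Fintype.sum_sum_type, fromCols_apply_inl,
    fromCols_apply_inr, fromRows_apply_inl, fromRows_apply_inr, Finset.sum_add_distrib,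
    sum_norm_sq_eq_sum_realCol_sq]

theorem dataNorm_eq_frob_fromCols (A : Matrix (Fin m) (Fin n) RBQ) (B : Matrix (Fin m) (Fin d) RBQ)
    (C : Matrix (Fin p) (Fin n) RBQ) (D : Matrix (Fin p) (Fin d) RBQ) :
    dataNorm A B C D = frob (fromCols (fromRows (realCol C) (realCol A))
      (fromRows (realCol D) (realCol B))) := by
  rw [dataNorm_eq_frob_realData, realData]
  congr 1
  ext (i | i) (j | j) <;> rfl

theorem realData_add (A A' : Matrix (Fin m) (Fin n) RBQ) (B B' : Matrix (Fin m) (Fin d) RBQ)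
    (C C' : Matrix (Fin p) (Fin n) RBQ) (D D' : Matrix (Fin p) (Fin d) RBQ) :
    realData (A + A') (B + B') (C + C') (D + D') = realData A B C D + realData A' B' C' D' := by
  simp only [realData, realCol_add]
  ext (i | i) (j | j) <;> rfl

theorem exists_realData_eq (M : Matrix (Fin (4 * p) ⊕ Fin (4 * m)) (Fin n ⊕ Fin d) ℝ) :
    ∃ (A : Matrix (Fin m) (Fin n) RBQ) (B : Matrix (Fin m) (Fin d) RBQ)
      (C : Matrix (Fin p) (Fin n) RBQ) (D : Matrix (Fin p) (Fin d) RBQ),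
      realData A B C D = M := by
  refine ⟨ofRealCol M.toRows₂.toCols₁, ofRealCol M.toRows₂.toCols₂,
    ofRealCol M.toRows₁.toCols₁, ofRealCol M.toRows₁.toCols₂, ?_⟩
  simp only [realData, realCol_ofRealCol, fromCols_toCols, fromRows_toRows]

end Reduction

/-- The matrix `[X; -I]`: the equation `A X = B` says that `[A, B]` annihilates its columns. -/
def aug {ι τ : Type*} [DecidableEq τ] (X : Matrix ι τ ℝ) : Matrix (ι ⊕ τ) τ ℝ :=
  fromRows X (-1)

theorem fromCols_mul_aug_eq_zero {μ ι τ : Type*} [Fintype ι] [Fintype τ] [DecidableEq τ]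
    (A : Matrix μ ι ℝ) (B : Matrix μ τ ℝ) (X : Matrix ι τ ℝ) :
    fromCols A B * aug X = 0 ↔ A * X = B := by
  rw [aug, fromCols_mul_fromRows, Matrix.mul_neg, Matrix.mul_one, ← sub_eq_add_neg, sub_eq_zero]

/-- `X` solves the real total least squares problem with equality constraints for the data
`D = [S; P]`: minimize `‖E‖_F` subject to `(P + E) [X; -I] = 0` and `S [X; -I] = 0`. -/
def IsTLSESol {ν μ ι τ : Type*} [Fintype μ] [Fintype ι] [Fintype τ] [DecidableEq τ]
    (D : Matrix (ν ⊕ μ) (ι ⊕ τ) ℝ) (X : Matrix ι τ ℝ) : Prop :=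
  D.toRows₁ * aug X = 0 ∧ ∃ E : Matrix μ (ι ⊕ τ) ℝ, (D.toRows₂ + E) * aug X = 0 ∧
    ∀ (X' : Matrix ι τ ℝ) (E' : Matrix μ (ι ⊕ τ) ℝ), D.toRows₁ * aug X' = 0 →
      (D.toRows₂ + E') * aug X' = 0 → frob E ≤ frob E'

section Reduction

variable {m n d p : ℕ} (A : Matrix (Fin m) (Fin n) RBQ) (B : Matrix (Fin m) (Fin d) RBQ)
  (C : Matrix (Fin p) (Fin n) RBQ) (D : Matrix (Fin p) (Fin d) RBQ) (X : Matrix (Fin n) (Fin d) ℝ)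

theorem feasible_iff (E : Matrix (Fin m) (Fin n) RBQ) (F : Matrix (Fin m) (Fin d) RBQ) :
    Feasible A B C D X E F ↔ (realData A B C D).toRows₁ * aug X = 0 ∧
      ((realData A B C D).toRows₂ + fromCols (realCol E) (realCol F)) * aug X = 0 := by
  have h : (realData A B C D).toRows₂ + fromCols (realCol E) (realCol F) =
      fromCols (realCol (A + E)) (realCol (B + F)) := by
    simp only [realData, realCol_add]
    ext i (j | j) <;> rfl
  rw [h, fromCols_mul_aug_eq_zero, realData, toRows₁_fromRows, fromCols_mul_aug_eq_zero,
    ← realCol_mul_map_ofReal, ← realCol_mul_map_ofReal, realCol_injective.eq_iff,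
    realCol_injective.eq_iff, Feasible, and_comm]

theorem isRealSolution_iff :
    IsRealSolution A B C D X ↔ IsTLSESol (realData A B C D) X := by
  have exists_fromCols (G : Matrix (Fin (4 * m)) (Fin n ⊕ Fin d) ℝ) :
      ∃ E F, G = fromCols (realCol E) (realCol F) :=
    ⟨ofRealCol G.toCols₁, ofRealCol G.toCols₂, by simp only [realCol_ofRealCol, fromCols_toCols]⟩
  simp only [IsRealSolution, IsTLSESol, feasible_iff, rbFrob_fromCols]
  constructor
  · rintro ⟨E, F, ⟨hS, hP⟩, hmin⟩
    refine ⟨hS, _, hP, fun X' E' hS' hP' => ?_⟩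
    obtain ⟨E, F, rfl⟩ := exists_fromCols E'
    exact hmin X' E F ⟨hS', hP'⟩
  · rintro ⟨hS, E, hP, hmin⟩
    obtain ⟨E, F, rfl⟩ := exists_fromCols E
    exact ⟨E, F, ⟨hS, hP⟩, fun X' E' F' h => hmin X' _ h.1 h.2⟩

end Reduction

/-! ### Total least squares as trace minimization -/

theorem isUnit_transpose_mul_self {κ τ : Type*} [Fintype κ] [Fintype τ] [DecidableEq τ]
    {N : Matrix κ τ ℝ} (hN : Function.Injective N.mulVec) : IsUnit (Nᵀ * N) := by
  simpa only [conjTranspose_eq_transpose_of_trivial] using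
    (PosDef.conjTranspose_mul_self N hN).isUnit

theorem mulVec_injective_of_posDef {κ τ : Type*} [Fintype κ] [Fintype τ] {N : Matrix κ τ ℝ}
    {Q : Matrix κ κ ℝ} (hQ : (Nᵀ * Q * N).PosDef) : Function.Injective N.mulVec := by
  refine (injective_iff_map_eq_zero N.mulVecLin).2 fun v hv => ?_
  rw [mulVecLin_apply] at hv
  by_contra hv0
  simpa [← mulVec_mulVec, hv] using hQ.dotProduct_mulVec_pos hv0

theorem trace_transpose_mul_mul_nonneg {κ β : Type*} [Fintype κ] [Fintype β] {Q : Matrix β β ℝ}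
    (hQ : Q.PosDef) (Z : Matrix β κ ℝ) : 0 ≤ (Zᵀ * Q * Z).trace :=
  (hQ.posSemidef.conjTranspose_mul_mul_same Z).trace_nonneg

theorem eq_zero_of_trace_transpose_mul_mul {κ β : Type*} [Fintype κ] [Fintype β]
    {Q : Matrix β β ℝ} (hQ : Q.PosDef) {Z : Matrix β κ ℝ} (h : (Zᵀ * Q * Z).trace = 0) :
    Z = 0 := by
  have hZ : Zᵀ * Q * Z = 0 :=
    (hQ.posSemidef.conjTranspose_mul_mul_same Z).trace_eq_zero_iff.1 h
  classical
  refine ext_of_mulVec_single fun j => ?_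
  rw [zero_mulVec]
  by_contra hv
  have hpos := hQ.dotProduct_mulVec_pos hv
  rw [star_trivial, mulVec_mulVec, ← vecMul_transpose, ← dotProduct_mulVec, mulVec_mulVec,
    ← Matrix.mul_assoc, hZ, zero_mulVec, dotProduct_zero] at hpos
  exact hpos.false

section Projection

variable {κ τ : Type*} [Fintype κ] [Fintype τ] [DecidableEq τ]

/-- The Moore–Penrose inverse of a matrix of full column rank. -/
noncomputable def pinv (N : Matrix κ τ ℝ) : Matrix τ κ ℝ := (Nᵀ * N)⁻¹ * Nᵀ

/-- The orthogonal projection onto the column space of a matrix of full column rank. -/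
noncomputable def proj (N : Matrix κ τ ℝ) : Matrix κ κ ℝ := N * pinv N

theorem pinv_mul_self {N : Matrix κ τ ℝ} (hN : IsUnit (Nᵀ * N)) : pinv N * N = 1 := by
  rw [pinv, Matrix.mul_assoc, nonsing_inv_mul _ ((isUnit_iff_isUnit_det _).1 hN)]

theorem proj_transpose (N : Matrix κ τ ℝ) : (proj N)ᵀ = proj N := by
  simp only [proj, pinv, transpose_mul, transpose_transpose, transpose_nonsing_inv,
    Matrix.mul_assoc]

theorem proj_mul_self {N : Matrix κ τ ℝ} (hN : IsUnit (Nᵀ * N)) : proj N * N = N := by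
  rw [proj, Matrix.mul_assoc, pinv_mul_self hN, Matrix.mul_one]

theorem transpose_mul_proj {N : Matrix κ τ ℝ} (hN : IsUnit (Nᵀ * N)) : Nᵀ * proj N = Nᵀ := by
  rw [← proj_transpose, ← transpose_mul, proj_mul_self hN]

theorem proj_mul_proj {N : Matrix κ τ ℝ} (hN : IsUnit (Nᵀ * N)) :
    proj N * proj N = proj N := by
  conv_lhs => rw [proj.eq_1, ← Matrix.mul_assoc, ← proj, proj_mul_self hN]
  rw [proj]

theorem trace_proj {N : Matrix κ τ ℝ} (hN : IsUnit (Nᵀ * N)) :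
    (proj N).trace = Fintype.card τ := by
  rw [proj, trace_mul_comm, pinv_mul_self hN, trace_one]

theorem proj_mul_mul_proj {β : Type*} [Fintype β] [DecidableEq β] (N : Matrix κ τ ℝ)
    (K : Matrix κ β ℝ) (m : Matrix κ κ ℝ) :
    proj K * m * proj N = (pinv K)ᵀ * (Kᵀ * m * N) * pinv N := by
  conv_lhs => rw [← proj_transpose K, proj, proj, transpose_mul]
  simp only [Matrix.mul_assoc]

end Projection

theorem trace_mul_sub_trace_mul {R κ : Type*} [CommRing R] [Fintype κ] [DecidableEq κ]
    {m p k r : Matrix κ κ R} (pp : p * p = p) (rr : r * r = r) (pk_r : (p + k) * r = r)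
    (r_pk : r * (p + k) = r) (kmp : k * m * p = 0) (pmk : p * m * k = 0) :
    (m * r).trace - (m * p).trace =
      (r * (k * m * k) * r).trace + ((1 - r) * (p * -m * p) * (1 - r)).trace := by
  have trace_conj {e f : Matrix κ κ R} (he : e * e = e) : (e * f * e).trace = (f * e).trace := by
    rw [trace_mul_comm, ← Matrix.mul_assoc, he, trace_mul_comm]
  have hsplit : (p + k) * m * (p + k) = p * m * p + k * m * k := by
    simp only [Matrix.add_mul, Matrix.mul_add, kmp, pmk]
    abel
  have hmr : (m * r).trace = (p * m * p * r).trace + (k * m * k * r).trace := by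
    calc (m * r).trace = (m * ((p + k) * r * (p + k))).trace := by rw [pk_r, r_pk]
      _ = ((p + k) * m * (p + k) * r).trace := by
        rw [← Matrix.mul_assoc, trace_mul_comm]
        simp only [Matrix.mul_assoc]
      _ = _ := by rw [hsplit, Matrix.add_mul, trace_add]
  have hmp : (m * p).trace = (p * m * p).trace := (trace_conj pp).symm
  rw [trace_conj rr, trace_conj (IsIdempotentElem.one_sub rr).eq, hmr, hmp, Matrix.mul_neg,
    Matrix.neg_mul, Matrix.mul_sub, Matrix.mul_one, Matrix.neg_mul, trace_sub, trace_neg,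
    trace_neg]
  ring

section KyFan

variable {κ τ β : Type*} [Fintype κ] [DecidableEq κ] [Fintype τ] [DecidableEq τ] [Fintype β]
  [DecidableEq β]

theorem trace_mul_proj_sub_trace_mul_proj {M : Matrix κ κ ℝ} (hM : Mᵀ = M) {N N' : Matrix κ τ ℝ}
    {K : Matrix κ β ℝ} (lam : ℝ) (hN : IsUnit (Nᵀ * N)) (hN' : IsUnit (N'ᵀ * N'))
    (hNK : Nᵀ * K = 0) (hKMN : Kᵀ * M * N = 0) (hspan : (proj N + proj K) * N' = N') :
    (M * proj N').trace - (M * proj N).trace =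
      ((pinv K * proj N')ᵀ * (Kᵀ * (M - lam • 1) * K) * (pinv K * proj N')).trace +
      ((pinv N * (1 - proj N'))ᵀ * (Nᵀ * (lam • 1 - M) * N) * (pinv N * (1 - proj N'))).trace := by
  set m := M - lam • (1 : Matrix κ κ ℝ) with hm
  have hKmN : Kᵀ * m * N = 0 := by
    have hKN : Kᵀ * N = 0 := by simpa using congrArg transpose hNK
    simp [hm, Matrix.mul_sub, Matrix.sub_mul, hKMN, hKN]
  have hNmK : Nᵀ * m * K = 0 := by
    simpa [hm, hM, Matrix.mul_assoc] using congrArg transpose hKmN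
  have pk_r : (proj N + proj K) * proj N' = proj N' := by
    rw [proj.eq_1 N', ← Matrix.mul_assoc, hspan]
  have r_pk : proj N' * (proj N + proj K) = proj N' := by
    simpa [proj_transpose] using congrArg transpose pk_r
  have key := trace_mul_sub_trace_mul (m := m) (proj_mul_proj hN) (proj_mul_proj hN') pk_r r_pk
    (by rw [proj_mul_mul_proj, hKmN]; simp) (by rw [proj_mul_mul_proj, hNmK]; simp)
  -- both projections have the same rank
  have hshift : (M * proj N').trace - (M * proj N).trace =
      (m * proj N').trace - (m * proj N).trace := by
    simp [hm, Matrix.sub_mul, trace_proj hN, trace_proj hN']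
  rw [hshift, key, proj_mul_mul_proj K K, proj_mul_mul_proj N N, hm, neg_sub]
  simp only [transpose_mul (pinv _), transpose_sub, transpose_one, proj_transpose,
    Matrix.mul_assoc]

end KyFan

section Objective

theorem frob_sq {ι κ : Type*} [Fintype ι] [Fintype κ] (M : Matrix ι κ ℝ) :
    frob M ^ 2 = (Mᵀ * M).trace := by
  rw [frob_eq_sqrt, Real.sq_sqrt (by positivity), Finset.sum_comm]
  simp only [trace, diag_apply, mul_apply, transpose_apply, pow_two]

theorem frob_nonneg {ι κ : Type*} [Fintype ι] [Fintype κ] (M : Matrix ι κ ℝ) : 0 ≤ frob M := by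
  rw [frob_eq_sqrt]
  exact Real.sqrt_nonneg _

theorem frob_le_frob_iff {ι κ ι' κ' : Type*} [Fintype ι] [Fintype κ] [Fintype ι'] [Fintype κ']
    {M : Matrix ι κ ℝ} {M' : Matrix ι' κ' ℝ} :
    frob M ≤ frob M' ↔ (Mᵀ * M).trace ≤ (M'ᵀ * M').trace := by
  rw [← frob_sq, ← frob_sq, sq_le_sq₀ (frob_nonneg M) (frob_nonneg M')]

variable {μ ν κ ι τ : Type*} [Fintype μ] [Fintype κ]

theorem trace_transpose_mul_self_mul (E : Matrix μ κ ℝ) {q : Matrix κ κ ℝ} (qt : qᵀ = q)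
    (qq : q * q = q) : ((E * q)ᵀ * (E * q)).trace = (Eᵀ * E * q).trace := by
  rw [transpose_mul, qt, Matrix.mul_assoc, trace_mul_comm q]
  simp only [Matrix.mul_assoc, qq]

theorem trace_transpose_mul_self_mul_le (E : Matrix μ κ ℝ) {q : Matrix κ κ ℝ}
    (qt : qᵀ = q) (qq : q * q = q) : (Eᵀ * E * q).trace ≤ (Eᵀ * E).trace := by
  classical
  have hcompl : (Eᵀ * E).trace - (Eᵀ * E * q).trace = frob (E * (1 - q)) ^ 2 := by
    rw [frob_sq, trace_transpose_mul_self_mul E (by rw [transpose_sub, qt, transpose_one])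
      (IsIdempotentElem.one_sub qq).eq, Matrix.mul_sub, trace_sub, Matrix.mul_one]
  linarith [sq_nonneg (frob (E * (1 - q)))]

theorem mulVec_aug_injective [Fintype τ] [DecidableEq τ] (X : Matrix ι τ ℝ) :
    Function.Injective (aug X).mulVec := by
  refine (injective_iff_map_eq_zero (aug X).mulVecLin).2 fun v hv => ?_
  rw [mulVecLin_apply, aug, fromRows_mulVec] at hv
  funext j
  simpa [neg_mulVec] using congrFun hv (Sum.inr j)

variable [Fintype ι] [Fintype τ] [DecidableEq τ]

theorem isUnit_aug (X : Matrix ι τ ℝ) : IsUnit ((aug X)ᵀ * aug X) :=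
  isUnit_transpose_mul_self (mulVec_aug_injective X)

theorem trace_mul_proj_le_of_add_mul_eq_zero {P E : Matrix μ κ ℝ}
    {N : Matrix κ τ ℝ} (hN : IsUnit (Nᵀ * N)) (h : (P + E) * N = 0) :
    (Pᵀ * P * proj N).trace ≤ (Eᵀ * E).trace := by
  have hE : E * proj N = -(P * proj N) := by
    rw [Matrix.add_mul] at h
    rw [proj, ← Matrix.mul_assoc, eq_neg_of_add_eq_zero_right h, Matrix.neg_mul, Matrix.mul_assoc]
  calc (Pᵀ * P * proj N).trace = (Eᵀ * E * proj N).trace := by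
        rw [← trace_transpose_mul_self_mul P (proj_transpose N) (proj_mul_proj hN),
          ← trace_transpose_mul_self_mul E (proj_transpose N) (proj_mul_proj hN), hE,
          transpose_neg, Matrix.neg_mul, Matrix.mul_neg, neg_neg]
    _ ≤ (Eᵀ * E).trace := trace_transpose_mul_self_mul_le E (proj_transpose N) (proj_mul_proj hN)

theorem isTLSESol_iff_trace_le {D : Matrix (ν ⊕ μ) (ι ⊕ τ) ℝ}
    {X : Matrix ι τ ℝ} :
    IsTLSESol D X ↔ D.toRows₁ * aug X = 0 ∧ ∀ Y, D.toRows₁ * aug Y = 0 →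
      (D.toRows₂ᵀ * D.toRows₂ * proj (aug X)).trace ≤
        (D.toRows₂ᵀ * D.toRows₂ * proj (aug Y)).trace := by
  -- the least correction that makes `Y` feasible is `-P * proj [Y; -I]`
  have feasible (Y : Matrix ι τ ℝ) :
      (D.toRows₂ + -(D.toRows₂ * proj (aug Y))) * aug Y = 0 := by
    rw [Matrix.add_mul, Matrix.neg_mul, Matrix.mul_assoc, proj_mul_self (isUnit_aug Y),
      add_neg_cancel]
  have value (Y : Matrix ι τ ℝ) :
      ((-(D.toRows₂ * proj (aug Y)))ᵀ * -(D.toRows₂ * proj (aug Y))).trace =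
        (D.toRows₂ᵀ * D.toRows₂ * proj (aug Y)).trace := by
    rw [transpose_neg, Matrix.neg_mul, Matrix.mul_neg, neg_neg,
      trace_transpose_mul_self_mul _ (proj_transpose _) (proj_mul_proj (isUnit_aug Y))]
  constructor
  · rintro ⟨hS, E, hE, hmin⟩
    refine ⟨hS, fun Y hY => (trace_mul_proj_le_of_add_mul_eq_zero (isUnit_aug X) hE).trans ?_⟩
    rw [← value Y, ← frob_le_frob_iff]
    exact hmin Y _ hY (feasible Y)
  · rintro ⟨hS, hmin⟩
    refine ⟨hS, _, feasible X, fun Y E hY hE => ?_⟩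
    rw [frob_le_frob_iff, value]
    exact (hmin Y hY).trans (trace_mul_proj_le_of_add_mul_eq_zero (isUnit_aug Y) hE)

theorem eq_of_proj_aug_mul_aug {X Y : Matrix ι τ ℝ} (h : proj (aug X) * aug Y = aug Y) :
    Y = X := by
  rw [proj, Matrix.mul_assoc] at h
  set G := pinv (aug X) * aug Y
  rw [aug, aug, fromRows_mul, fromRows_inj.eq_iff, Matrix.neg_mul, Matrix.one_mul, neg_inj] at h
  rw [← h.1, h.2, Matrix.mul_one]

end Objective

section Certificate

variable {ν μ ι τ β : Type*} [Fintype ν] [Fintype μ] [Fintype ι] [DecidableEq ι] [Fintype τ]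
  [DecidableEq τ] [Fintype β]

/-- A certificate that `X` is the unique minimizer: the columns of `K` span the orthogonal
complement of those of `[X; -I]` in `ker S`, the quadratic form of `PᵀP` splits along these two
subspaces, and it lies below `lam` on the first and above `lam` on the second. -/
structure IsCertificate (D : Matrix (ν ⊕ μ) (ι ⊕ τ) ℝ) (lam : ℝ) (X : Matrix ι τ ℝ)
    (K : Matrix (ι ⊕ τ) β ℝ) : Prop where
  constraint_aug : D.toRows₁ * aug X = 0
  constraint_ker : D.toRows₁ * K = 0
  orthogonal : (aug X)ᵀ * K = 0
  stationary : (D.toRows₂ * K)ᵀ * (D.toRows₂ * aug X) = 0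
  below : ((aug X)ᵀ * (lam • 1 - D.toRows₂ᵀ * D.toRows₂) * aug X).PosDef
  above : (Kᵀ * (D.toRows₂ᵀ * D.toRows₂ - lam • 1) * K).PosDef
  spanning : (aug X * (aug X)ᵀ + K * Kᵀ + D.toRows₁ᵀ * D.toRows₁).PosDef

namespace IsCertificate

variable {D : Matrix (ν ⊕ μ) (ι ⊕ τ) ℝ} {lam : ℝ} {X Y : Matrix ι τ ℝ} {K : Matrix (ι ⊕ τ) β ℝ}

theorem eq_zero_of_mul_eq_zero {α : Type*} [Finite α] (h : IsCertificate D lam X K)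
    {Z : Matrix (ι ⊕ τ) α ℝ} (hN : (aug X)ᵀ * Z = 0) (hK : Kᵀ * Z = 0)
    (hS : D.toRows₁ * Z = 0) : Z = 0 := by
  cases nonempty_fintype α
  refine eq_zero_of_trace_transpose_mul_mul h.spanning ?_
  rw [Matrix.mul_assoc, Matrix.add_mul, Matrix.add_mul, Matrix.mul_assoc, Matrix.mul_assoc,
    Matrix.mul_assoc, hN, hK, hS]
  simp

theorem isUnit_ker [DecidableEq β] (h : IsCertificate D lam X K) : IsUnit (Kᵀ * K) :=
  isUnit_transpose_mul_self (mulVec_injective_of_posDef h.above)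

theorem proj_add_proj_mul_aug [DecidableEq β] (h : IsCertificate D lam X K)
    (hY : D.toRows₁ * aug Y = 0) :
    (proj (aug X) + proj K) * aug Y = aug Y := by
  have hKN : Kᵀ * aug X = 0 := by simpa using congrArg transpose h.orthogonal
  refine (sub_eq_zero.1 (h.eq_zero_of_mul_eq_zero ?_ ?_ ?_)).symm
  · rw [Matrix.mul_sub, ← Matrix.mul_assoc, Matrix.mul_add, transpose_mul_proj (isUnit_aug X),
      proj, ← Matrix.mul_assoc, h.orthogonal, Matrix.zero_mul, add_zero, sub_self]
  · rw [Matrix.mul_sub, ← Matrix.mul_assoc, Matrix.mul_add, transpose_mul_proj h.isUnit_ker,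
      proj, ← Matrix.mul_assoc, hKN, Matrix.zero_mul, zero_add, sub_self]
  · rw [Matrix.mul_sub, hY, ← Matrix.mul_assoc, Matrix.mul_add, proj, proj, ← Matrix.mul_assoc,
      ← Matrix.mul_assoc, h.constraint_aug, h.constraint_ker]
    simp

theorem trace_le_and_eq (h : IsCertificate D lam X K) (hY : D.toRows₁ * aug Y = 0) :
    (D.toRows₂ᵀ * D.toRows₂ * proj (aug X)).trace ≤
        (D.toRows₂ᵀ * D.toRows₂ * proj (aug Y)).trace ∧
      ((D.toRows₂ᵀ * D.toRows₂ * proj (aug Y)).trace ≤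
        (D.toRows₂ᵀ * D.toRows₂ * proj (aug X)).trace → Y = X) := by
  classical
  have hspan := h.proj_add_proj_mul_aug hY
  have hdiff := trace_mul_proj_sub_trace_mul_proj (M := D.toRows₂ᵀ * D.toRows₂) (by simp) lam
    (isUnit_aug X) (isUnit_aug Y) h.orthogonal
    (by rw [← h.stationary, transpose_mul]; simp only [Matrix.mul_assoc]) hspan
  have habove := trace_transpose_mul_mul_nonneg h.above (pinv K * proj (aug Y))
  have hbelow := trace_transpose_mul_mul_nonneg h.below (pinv (aug X) * (1 - proj (aug Y)))
  refine ⟨by linarith, fun hle => eq_of_proj_aug_mul_aug ?_⟩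
  have hKY : pinv K * proj (aug Y) = 0 :=
    eq_zero_of_trace_transpose_mul_mul h.above (by linarith)
  have hKN : proj K * aug Y = 0 := by
    rw [← proj_mul_self (isUnit_aug Y), ← Matrix.mul_assoc, proj.eq_1 K, Matrix.mul_assoc K, hKY,
      Matrix.mul_zero, Matrix.zero_mul]
  rwa [Matrix.add_mul, hKN, add_zero] at hspan

theorem isTLSESol_iff_eq (h : IsCertificate D lam X K) : IsTLSESol D Y ↔ Y = X := by
  rw [isTLSESol_iff_trace_le]
  constructor
  · rintro ⟨hY, hmin⟩
    exact (h.trace_le_and_eq hY).2 (hmin X h.constraint_aug)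
  · rintro rfl
    exact ⟨h.constraint_aug, fun Z hZ => (h.trace_le_and_eq hZ).1⟩

end IsCertificate

end Certificate

/-! ### The system of equations for the solution -/

theorem exists_implicit_function {E U W : Type*} [NormedAddCommGroup E] [NormedSpace ℝ E]
    [CompleteSpace E] [NormedAddCommGroup U] [NormedSpace ℝ U] [FiniteDimensional ℝ U]
    [NormedAddCommGroup W] [NormedSpace ℝ W] [FiniteDimensional ℝ W]
    (hdim : Module.finrank ℝ U = Module.finrank ℝ W) {F : E × U → W} {F' : E × U →L[ℝ] W} {x₀ : E}
    {u₀ : U} (hF : HasStrictFDerivAt F F' (x₀, u₀)) (h0 : F (x₀, u₀) = 0)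
    (hinj : ∀ u, F' (0, u) = 0 → u = 0) :
    ∃ (ψ : E → U) (ψ' : E →L[ℝ] U), HasStrictFDerivAt ψ ψ' x₀ ∧ ψ x₀ = u₀ ∧
      (∀ᶠ x in 𝓝 x₀, F (x, ψ x) = 0) ∧ ∀ v, F' (v, ψ' v) = 0 := by
  have : CompleteSpace U := FiniteDimensional.complete ℝ U
  have : CompleteSpace W := FiniteDimensional.complete ℝ W
  have hinv : (F' ∘L .inr ℝ E U).IsInvertible := by
    let e := LinearMap.linearEquivOfInjective (F' ∘L .inr ℝ E U).toLinearMap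
      ((injective_iff_map_eq_zero _).2 fun u hu => hinj u (by simpa using hu)) hdim
    exact ⟨e.toContinuousLinearEquiv, by ext u; rfl⟩
  have hev := hF.eventually_apply_implicitFunctionOfProdDomain hinv
  simp only [h0] at hev
  refine ⟨_, _, hF.hasStrictFDerivAt_implicitFunctionOfProdDomain hinv,
    (hF.eventually_apply_eq_iff_implicitFunctionOfProdDomain hinv).self_of_nhds.mp rfl, hev,
    fun v => ?_⟩
  obtain ⟨e, he⟩ := hinv
  rw [← ContinuousLinearMap.coprod_comp_inl_inr F', ContinuousLinearMap.coprod_apply, ← he]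
  simp

section Calculus

open scoped Matrix.Norms.Frobenius

variable {l m n : Type*} [Fintype l] [Fintype m] [Fintype n]

/-- Matrix multiplication as a continuous bilinear map. -/
noncomputable def mulCLM (l m n : Type*) [Fintype l] [Fintype m] [Fintype n] :
    Matrix l m ℝ →L[ℝ] Matrix m n ℝ →L[ℝ] Matrix l n ℝ :=
  (LinearMap.mk₂ ℝ (fun (A : Matrix l m ℝ) (B : Matrix m n ℝ) => A * B) Matrix.add_mul
    Matrix.smul_mul Matrix.mul_add fun c A B => Matrix.mul_smul A c B).toContinuousBilinearMap

/-- Transposition as a continuous linear map. -/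
noncomputable def transposeCLM (l m : Type*) [Fintype l] [Fintype m] :
    Matrix l m ℝ →L[ℝ] Matrix m l ℝ :=
  (transposeLinearEquiv l m ℝ ℝ).toLinearMap.toContinuousLinearMap

/-- The upper block as a continuous linear map. -/
noncomputable def toRows₁CLM (l m n : Type*) [Fintype l] [Fintype m] [Fintype n] :
    Matrix (l ⊕ m) n ℝ →L[ℝ] Matrix l n ℝ :=
  LinearMap.toContinuousLinearMap
    { toFun := toRows₁, map_add' := fun _ _ => rfl, map_smul' := fun _ _ => rfl }

/-- The lower block as a continuous linear map. -/
noncomputable def toRows₂CLM (l m n : Type*) [Fintype l] [Fintype m] [Fintype n] :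
    Matrix (l ⊕ m) n ℝ →L[ℝ] Matrix m n ℝ :=
  LinearMap.toContinuousLinearMap
    { toFun := toRows₂, map_add' := fun _ _ => rfl, map_smul' := fun _ _ => rfl }

/-- Extension by zero rows, which is the linear part of the affine map `aug`. -/
noncomputable def padCLM (l m n : Type*) [Fintype l] [Fintype m] [Fintype n] :
    Matrix l n ℝ →L[ℝ] Matrix (l ⊕ m) n ℝ :=
  LinearMap.toContinuousLinearMap
    { toFun := fun A => fromRows A 0
      map_add' := fun _ _ => by ext (i | i) j <;> simp
      map_smul' := fun _ _ => by ext (i | i) j <;> simp }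

theorem aug_eq_padCLM_add [DecidableEq n] (X : Matrix l n ℝ) :
    aug X = padCLM l n n X + fromRows 0 (-1) := by
  change _ = fromRows X 0 + _
  ext (i | i) j <;> simp [aug]

variable {E : Type*} [NormedAddCommGroup E] [NormedSpace ℝ E] {x : E}

theorem hasStrictFDerivAt_matrix_mul {f : E → Matrix l m ℝ} {g : E → Matrix m n ℝ}
    {f' : E →L[ℝ] Matrix l m ℝ} {g' : E →L[ℝ] Matrix m n ℝ}
    (hf : HasStrictFDerivAt f f' x) (hg : HasStrictFDerivAt g g' x) :
    HasStrictFDerivAt (fun y => f y * g y)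
      ((mulCLM l m n).precompR E (f x) g' + (mulCLM l m n).precompL E f' (g x)) x :=
  (mulCLM l m n).hasStrictFDerivAt_of_bilinear hf hg

theorem hasStrictFDerivAt_matrix_transpose {f : E → Matrix l m ℝ} {f' : E →L[ℝ] Matrix l m ℝ}
    (hf : HasStrictFDerivAt f f' x) :
    HasStrictFDerivAt (fun y => (f y)ᵀ) (transposeCLM l m ∘L f') x :=
  (transposeCLM l m).hasStrictFDerivAt.comp x hf

end Calculus

theorem finrank_unknowns_eq_finrank_equations {ν ι β : Type*} (τ : Type*) [Fintype ν]
    [Fintype ι] [Finite τ] [Fintype β] (h : Fintype.card ι = Fintype.card ν + Fintype.card β) :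
    Module.finrank ℝ (Matrix ι τ ℝ × Matrix (ι ⊕ τ) β ℝ) =
      Module.finrank ℝ
        (Matrix ν τ ℝ × Matrix β τ ℝ × Matrix τ β ℝ × Matrix ν β ℝ × Matrix β β ℝ) := by
  cases nonempty_fintype τ
  simp only [Module.finrank_prod, Module.finrank_matrix, Module.finrank_self, mul_one,
    Fintype.card_sum, h]
  ring

section System

variable {ν μ ι τ β : Type*} [Fintype μ] [Fintype ι] [Fintype τ] [DecidableEq τ] [DecidableEq β]

/-- The data, a candidate solution `X` and a candidate basis `K` of the complement of `[X; -I]` in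
the kernel of the constraints. -/
abbrev Point (ν μ ι τ β : Type*) : Type _ :=
  Matrix (ν ⊕ μ) (ι ⊕ τ) ℝ × Matrix ι τ ℝ × Matrix (ι ⊕ τ) β ℝ

/-- The left-hand sides of the polynomial equations in an `IsCertificate`. The last component
normalizes `K`, so that there are as many equations as unknowns. -/
def system (V : Matrix (ι ⊕ τ) β ℝ) (z : Point ν μ ι τ β) :
    Matrix ν τ ℝ × Matrix β τ ℝ × Matrix τ β ℝ × Matrix ν β ℝ × Matrix β β ℝ :=
  (z.1.toRows₁ * aug z.2.1, (z.1.toRows₂ * z.2.2)ᵀ * (z.1.toRows₂ * aug z.2.1),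
    (aug z.2.1)ᵀ * z.2.2, z.1.toRows₁ * z.2.2, Vᵀ * z.2.2 - 1)

open scoped Matrix.Norms.Frobenius

theorem exists_hasStrictFDerivAt_system [Finite ν] [Finite β] (V : Matrix (ι ⊕ τ) β ℝ)
    (D : Matrix (ν ⊕ μ) (ι ⊕ τ) ℝ) (X : Matrix ι τ ℝ) (K : Matrix (ι ⊕ τ) β ℝ) :
    ∃ F' : Point ν μ ι τ β →L[ℝ] _, HasStrictFDerivAt (system V) F' (D, X, K) ∧
      ∀ ΔD ΔX ΔK, F' (ΔD, ΔX, ΔK) =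
        (D.toRows₁ * fromRows ΔX (0 : Matrix τ τ ℝ) + ΔD.toRows₁ * aug X,
          (D.toRows₂ * K)ᵀ * (D.toRows₂ * fromRows ΔX (0 : Matrix τ τ ℝ) + ΔD.toRows₂ * aug X) +
            (D.toRows₂ * ΔK + ΔD.toRows₂ * K)ᵀ * (D.toRows₂ * aug X),
          (aug X)ᵀ * ΔK + (fromRows ΔX (0 : Matrix τ τ ℝ))ᵀ * K,
          D.toRows₁ * ΔK + ΔD.toRows₁ * K, Vᵀ * ΔK) := by
  cases nonempty_fintype ν
  cases nonempty_fintype β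
  have hS : HasStrictFDerivAt (fun z : Point ν μ ι τ β => z.1.toRows₁)
      (toRows₁CLM ν μ (ι ⊕ τ) ∘L .fst ℝ _ _) (D, X, K) :=
    (toRows₁CLM ν μ (ι ⊕ τ)).hasStrictFDerivAt.comp _ hasStrictFDerivAt_fst
  have hP : HasStrictFDerivAt (fun z : Point ν μ ι τ β => z.1.toRows₂)
      (toRows₂CLM ν μ (ι ⊕ τ) ∘L .fst ℝ _ _) (D, X, K) :=
    (toRows₂CLM ν μ (ι ⊕ τ)).hasStrictFDerivAt.comp _ hasStrictFDerivAt_fst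
  have hK : HasStrictFDerivAt (fun z : Point ν μ ι τ β => z.2.2)
      (.snd ℝ _ _ ∘L .snd ℝ _ _) (D, X, K) :=
    hasStrictFDerivAt_snd.comp _ hasStrictFDerivAt_snd
  have hX : HasStrictFDerivAt (fun z : Point ν μ ι τ β => z.2.1)
      (.fst ℝ _ _ ∘L .snd ℝ _ _) (D, X, K) :=
    hasStrictFDerivAt_fst.comp _ hasStrictFDerivAt_snd
  have hN : HasStrictFDerivAt (fun z : Point ν μ ι τ β => aug z.2.1)
      (padCLM ι τ τ ∘L .fst ℝ _ _ ∘L .snd ℝ _ _) (D, X, K) := by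
    simp only [aug_eq_padCLM_add]
    exact ((padCLM ι τ τ).hasStrictFDerivAt.comp _ hX).add_const _
  have hV : HasStrictFDerivAt (fun z : Point ν μ ι τ β => Vᵀ * z.2.2 - 1)
      (mulCLM β (ι ⊕ τ) β Vᵀ ∘L .snd ℝ _ _ ∘L .snd ℝ _ _) (D, X, K) :=
    ((mulCLM β (ι ⊕ τ) β Vᵀ).hasStrictFDerivAt.comp _ hK).sub_const _
  exact ⟨_, (hasStrictFDerivAt_matrix_mul hS hN).prodMk
    ((hasStrictFDerivAt_matrix_mul
      (hasStrictFDerivAt_matrix_transpose (hasStrictFDerivAt_matrix_mul hP hK))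
      (hasStrictFDerivAt_matrix_mul hP hN)).prodMk
    ((hasStrictFDerivAt_matrix_mul (hasStrictFDerivAt_matrix_transpose hN) hK).prodMk
    ((hasStrictFDerivAt_matrix_mul hS hK).prodMk hV))), fun _ _ _ => rfl⟩

end System

theorem eventually_posDef {E n : Type*} [TopologicalSpace E] [Finite n] {x₀ : E}
    {Q : E → Matrix n n ℝ} (hQ : ContinuousAt Q x₀) (hQ' : ∀ x, (Q x).IsHermitian)
    (h : (Q x₀).PosDef) : ∀ᶠ x in 𝓝 x₀, (Q x).PosDef := by
  cases nonempty_fintype n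
  have hform : Continuous fun z : Matrix n n ℝ × (n → ℝ) => z.2 ⬝ᵥ (z.1 *ᵥ z.2) :=
    continuous_snd.dotProduct (continuous_fst.matrix_mulVec continuous_snd)
  have hsphere : ∀ᶠ A in 𝓝 (Q x₀), ∀ v ∈ Metric.sphere (0 : n → ℝ) 1, 0 < v ⬝ᵥ (A *ᵥ v) := by
    refine (isCompact_sphere _ _).eventually_forall_of_forall_eventually fun v hv => ?_
    exact hform.continuousAt.eventually
      (lt_mem_nhds (h.dotProduct_mulVec_pos (ne_zero_of_mem_unit_sphere ⟨v, hv⟩)))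
  filter_upwards [hQ.eventually hsphere] with x hx
  refine .of_dotProduct_mulVec_pos (hQ' x) fun v hv => ?_
  have hv' : 0 < ‖v‖⁻¹ := inv_pos.2 (norm_pos_iff.2 hv)
  have hpos := hx (‖v‖⁻¹ • v) (by
    rw [mem_sphere_zero_iff_norm, norm_smul, norm_inv, norm_norm,
      inv_mul_cancel₀ (norm_ne_zero_iff.2 hv)])
  rw [mulVec_smul, smul_dotProduct, dotProduct_smul, smul_eq_mul, smul_eq_mul] at hpos
  exact pos_of_mul_pos_right (pos_of_mul_pos_right hpos hv'.le) hv'.le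

section Persistence

variable {ν μ ι τ β : Type*}

theorem continuous_aug [DecidableEq τ] :
    Continuous (aug : Matrix ι τ ℝ → Matrix (ι ⊕ τ) τ ℝ) := by
  refine continuous_matrix fun i j => ?_
  rcases i with i | i
  · exact continuous_id.matrix_elem i j
  · exact continuous_const

theorem IsCertificate.eventually [Fintype ν] [Fintype μ] [Fintype ι] [DecidableEq ι] [Fintype τ]
    [DecidableEq τ] [Fintype β] [DecidableEq β] {D : Matrix (ν ⊕ μ) (ι ⊕ τ) ℝ} {lam : ℝ}
    {X : Matrix ι τ ℝ} {K : Matrix (ι ⊕ τ) β ℝ} (h : IsCertificate D lam X K)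
    (V : Matrix (ι ⊕ τ) β ℝ) :
    ∀ᶠ z : Point ν μ ι τ β in 𝓝 (D, X, K),
      system V z = 0 → IsCertificate z.1 lam z.2.1 z.2.2 := by
  have hS : Continuous fun z : Point ν μ ι τ β => z.1.toRows₁ :=
    continuous_fst.matrix_submatrix Sum.inl id
  have hP : Continuous fun z : Point ν μ ι τ β => z.1.toRows₂ :=
    continuous_fst.matrix_submatrix Sum.inr id
  have hN : Continuous fun z : Point ν μ ι τ β => aug z.2.1 :=
    continuous_aug.comp continuous_snd.fst
  have hK : Continuous fun z : Point ν μ ι τ β => z.2.2 := continuous_snd.snd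
  have hM := hP.matrix_transpose.matrix_mul hP
  have hlam : Continuous fun _ : Point ν μ ι τ β => lam • (1 : Matrix (ι ⊕ τ) (ι ⊕ τ) ℝ) :=
    continuous_const
  have hbelow := eventually_posDef (x₀ := (D, X, K))
    ((hN.matrix_transpose.matrix_mul (hlam.sub hM)).matrix_mul hN).continuousAt
    (fun z => by simp [IsHermitian, Matrix.mul_assoc]) h.below
  have habove := eventually_posDef (x₀ := (D, X, K))
    ((hK.matrix_transpose.matrix_mul (hM.sub hlam)).matrix_mul hK).continuousAt
    (fun z => by simp [IsHermitian, Matrix.mul_assoc]) h.above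
  have hspanning := eventually_posDef (x₀ := (D, X, K))
    (((hN.matrix_mul hN.matrix_transpose).add (hK.matrix_mul hK.matrix_transpose)).add
      (hS.matrix_transpose.matrix_mul hS)).continuousAt
    (fun z => by simp [IsHermitian]) h.spanning
  filter_upwards [hbelow, habove, hspanning] with z hb ha hs hz
  simp only [system, Prod.ext_iff] at hz
  exact ⟨hz.1, hz.2.2.2.1, hz.2.2.1, hz.2.1, hb, ha, hs⟩

end Persistence

/-! ### Bases adapted to the data -/

theorem transpose_mul_gram_sub_mul {μ κ α : Type*} [Fintype μ] [Fintype κ] [DecidableEq κ]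
    [Fintype α] [DecidableEq α] {P : Matrix μ κ ℝ} {U : Matrix μ α ℝ} {σ : α → ℝ}
    {V : Matrix κ α ℝ} {lam : ℝ} (hV : Vᵀ * V = 1) (hU : Uᵀ * U = 1)
    (hPV : P * V = U * diagonal σ) :
    Vᵀ * (Pᵀ * P - lam • 1) * V = diagonal fun i => σ i ^ 2 - lam := by
  calc Vᵀ * (Pᵀ * P - lam • 1) * V = (P * V)ᵀ * (P * V) - lam • (Vᵀ * V) := by
        simp [Matrix.mul_sub, Matrix.sub_mul, Matrix.mul_assoc]
    _ = diagonal σ * (Uᵀ * U) * diagonal σ - lam • 1 := by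
        rw [hV, hPV, transpose_mul, diagonal_transpose]
        simp only [Matrix.mul_assoc]
    _ = _ := by
        rw [hU, Matrix.mul_one, diagonal_mul_diagonal, smul_one_eq_diagonal, diagonal_sub]
        simp only [sq]

theorem diagonal_inv_mul_transpose_mul {μ κ α : Type*} [Fintype μ] [Fintype α] [DecidableEq α]
    {U : Matrix μ α ℝ} {s : α → ℝ} {V : Matrix κ α ℝ} (hU : Uᵀ * U = 1) (hs : ∀ i, s i ≠ 0) :
    diagonal s⁻¹ * Uᵀ * (U * diagonal s * Vᵀ) = Vᵀ := by
  have hss : diagonal s⁻¹ * diagonal s = 1 := by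
    rw [diagonal_mul_diagonal, ← diagonal_one]
    exact congrArg diagonal (funext fun i => inv_mul_cancel₀ (hs i))
  calc diagonal s⁻¹ * Uᵀ * (U * diagonal s * Vᵀ)
      = diagonal s⁻¹ * (Uᵀ * U) * diagonal s * Vᵀ := by simp only [Matrix.mul_assoc]
    _ = Vᵀ := by rw [hU, Matrix.mul_one, hss, Matrix.one_mul]

/-- Singular value decompositions adapted to the data `D = [S; P]`: `S = U_s diag(s) V_sᵀ`, and
`P` acts on the kernel of `S`, which has the orthonormal basis `[V₁, V₂]`, by
`P V₁ = U₁ diag(σ₁)` and `P V₂ = U₂ diag(σ₂)`. The lower block of `V₂` is invertible, so that the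
columns of `V₂` span the same space as those of some `[X; -I]`. -/
structure AdaptedSVD {ν μ ι τ : Type*} [Fintype ν] [DecidableEq ν] [Fintype μ] [Fintype ι]
    [Fintype τ] [DecidableEq τ] (D : Matrix (ν ⊕ μ) (ι ⊕ τ) ℝ) (β : Type*) [Fintype β]
    [DecidableEq β] where
  Us : Matrix ν ν ℝ
  s : ν → ℝ
  Vs : Matrix (ι ⊕ τ) ν ℝ
  U1 : Matrix μ β ℝ
  σ1 : β → ℝ
  V1 : Matrix (ι ⊕ τ) β ℝ
  U2 : Matrix μ τ ℝ
  σ2 : τ → ℝ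
  V2 : Matrix (ι ⊕ τ) τ ℝ
  card_eq : Fintype.card ι = Fintype.card ν + Fintype.card β
  Us_Us : Usᵀ * Us = 1
  s_ne : ∀ i, s i ≠ 0
  Vs_Vs : Vsᵀ * Vs = 1
  Vs_V1 : Vsᵀ * V1 = 0
  Vs_V2 : Vsᵀ * V2 = 0
  V1_V1 : V1ᵀ * V1 = 1
  V1_V2 : V1ᵀ * V2 = 0
  V2_V2 : V2ᵀ * V2 = 1
  U1_U1 : U1ᵀ * U1 = 1
  U1_U2 : U1ᵀ * U2 = 0
  U2_U2 : U2ᵀ * U2 = 1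
  S_eq : D.toRows₁ = Us * diagonal s * Vsᵀ
  P_V1 : D.toRows₂ * V1 = U1 * diagonal σ1
  P_V2 : D.toRows₂ * V2 = U2 * diagonal σ2
  nonneg : ∀ j, 0 ≤ σ2 j
  gap : ∀ i j, σ2 j < σ1 i
  isUnit_V22 : IsUnit V2.toRows₂

namespace AdaptedSVD

variable {ν μ ι τ β : Type*} [Fintype ν] [DecidableEq ν] [Fintype μ] [Fintype ι] [Fintype τ]
  [DecidableEq τ] [Fintype β] [DecidableEq β] {D : Matrix (ν ⊕ μ) (ι ⊕ τ) ℝ}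

theorem V1_Vs (h : AdaptedSVD D β) : h.V1ᵀ * h.Vs = 0 := by
  simpa using congrArg transpose h.Vs_V1

theorem V2_Vs (h : AdaptedSVD D β) : h.V2ᵀ * h.Vs = 0 := by
  simpa using congrArg transpose h.Vs_V2

theorem V2_V1 (h : AdaptedSVD D β) : h.V2ᵀ * h.V1 = 0 := by
  simpa using congrArg transpose h.V1_V2

theorem complete [DecidableEq ι] (h : AdaptedSVD D β) :
    h.Vs * h.Vsᵀ + h.V1 * h.V1ᵀ + h.V2 * h.V2ᵀ = 1 := by
  have hV : fromRows (fromRows h.Vsᵀ h.V1ᵀ) h.V2ᵀ * fromCols (fromCols h.Vs h.V1) h.V2 = 1 := by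
    rw [fromRows_mul_fromCols, fromRows_mul_fromCols, fromRows_mul, mul_fromCols, h.Vs_Vs, h.Vs_V1,
      h.V1_Vs, h.V1_V1, h.Vs_V2, h.V1_V2, h.V2_Vs, h.V2_V1, h.V2_V2]
    simp
  have hV' := (mul_eq_one_comm_of_card_eq _ _ _ (by simp [h.card_eq, add_comm])).1 hV
  rwa [fromCols_mul_fromRows, fromCols_mul_fromRows] at hV'

theorem ext_of_mul_eq [Finite ι] {α : Type*} (h : AdaptedSVD D β) {Z Z' : Matrix (ι ⊕ τ) α ℝ}
    (hs : h.Vsᵀ * Z = h.Vsᵀ * Z') (h1 : h.V1ᵀ * Z = h.V1ᵀ * Z') (h2 : h.V2ᵀ * Z = h.V2ᵀ * Z') :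
    Z = Z' := by
  classical
  rw [← Matrix.one_mul Z, ← Matrix.one_mul Z', ← h.complete]
  simp only [Matrix.add_mul, Matrix.mul_assoc, hs, h1, h2]

theorem S_V1 (h : AdaptedSVD D β) : D.toRows₁ * h.V1 = 0 := by
  rw [h.S_eq, Matrix.mul_assoc, h.Vs_V1, Matrix.mul_zero]

theorem S_V2 (h : AdaptedSVD D β) : D.toRows₁ * h.V2 = 0 := by
  rw [h.S_eq, Matrix.mul_assoc, h.Vs_V2, Matrix.mul_zero]

/-- The inverse of `U_s diag(s)`, which turns the constraint matrix `S` into `V_sᵀ`. -/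
noncomputable def normalizer (h : AdaptedSVD D β) : Matrix ν ν ℝ := diagonal h.s⁻¹ * h.Usᵀ

theorem normalizer_mul_S (h : AdaptedSVD D β) : h.normalizer * D.toRows₁ = h.Vsᵀ := by
  rw [h.S_eq, normalizer, diagonal_inv_mul_transpose_mul h.Us_Us h.s_ne]

/-- The Moore–Penrose inverse of the constraint matrix `S`. -/
noncomputable def pinvS (h : AdaptedSVD D β) : Matrix (ι ⊕ τ) ν ℝ := h.Vs * h.normalizer

theorem P_mul {α : Type*} (h : AdaptedSVD D β) (Z : Matrix (ι ⊕ τ) α ℝ) :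
    D.toRows₂ * Z = h.U1 * diagonal h.σ1 * (h.V1ᵀ * Z) + h.U2 * diagonal h.σ2 * (h.V2ᵀ * Z) +
      D.toRows₂ * h.pinvS * (D.toRows₁ * Z) := by
  classical
  calc D.toRows₂ * Z
      = D.toRows₂ * ((h.Vs * h.Vsᵀ + h.V1 * h.V1ᵀ + h.V2 * h.V2ᵀ) * Z) := by
        rw [h.complete, Matrix.one_mul]
    _ = _ := by
        rw [← h.P_V1, ← h.P_V2, ← h.normalizer_mul_S, pinvS]
        simp only [Matrix.add_mul, Matrix.mul_add, Matrix.mul_assoc]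
        abel

theorem sq_lt_sq (h : AdaptedSVD D β) (i : β) (j : τ) : h.σ2 j ^ 2 < h.σ1 i ^ 2 :=
  pow_lt_pow_left₀ (h.gap i j) (h.nonneg j) two_ne_zero

theorem exists_between_sq (h : AdaptedSVD D β) :
    ∃ lam, (∀ j, h.σ2 j ^ 2 < lam) ∧ ∀ i, lam < h.σ1 i ^ 2 := by
  obtain ⟨lam, h2, h1⟩ := Order.exists_between_finsets
    (Finset.univ.image fun j => h.σ2 j ^ 2) (Finset.univ.image fun i => h.σ1 i ^ 2) (by
      simp only [Finset.mem_image, Finset.mem_univ, true_and]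
      rintro _ ⟨j, rfl⟩ _ ⟨i, rfl⟩
      exact h.sq_lt_sq i j)
  exact ⟨lam, fun j => h2 _ (Finset.mem_image_of_mem _ (Finset.mem_univ j)),
    fun i => h1 _ (Finset.mem_image_of_mem _ (Finset.mem_univ i))⟩

/-- The solution of the unperturbed problem. -/
noncomputable def sol (h : AdaptedSVD D β) : Matrix ι τ ℝ := -(h.V2.toRows₁ * h.V2.toRows₂⁻¹)

theorem aug_sol (h : AdaptedSVD D β) : aug h.sol = h.V2 * -h.V2.toRows₂⁻¹ := by
  have hV22 := mul_nonsing_inv _ ((isUnit_iff_isUnit_det _).1 h.isUnit_V22)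
  have hrows : h.V2 * -h.V2.toRows₂⁻¹ =
      fromRows (h.V2.toRows₁ * -h.V2.toRows₂⁻¹) (h.V2.toRows₂ * -h.V2.toRows₂⁻¹) := by
    rw [← fromRows_mul, fromRows_toRows]
  rw [hrows, Matrix.mul_neg, Matrix.mul_neg, hV22, aug, sol]

theorem aug_sol_mul (h : AdaptedSVD D β) : aug h.sol * h.V2.toRows₂ = -h.V2 := by
  rw [aug_sol, Matrix.mul_neg, Matrix.neg_mul, Matrix.mul_assoc,
    nonsing_inv_mul _ ((isUnit_iff_isUnit_det _).1 h.isUnit_V22), Matrix.mul_one]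

theorem isCertificate [DecidableEq ι] (h : AdaptedSVD D β) {lam : ℝ} (h2 : ∀ j, h.σ2 j ^ 2 < lam)
    (h1 : ∀ i, lam < h.σ1 i ^ 2) : IsCertificate D lam h.sol h.V1 where
  constraint_aug := by rw [aug_sol, ← Matrix.mul_assoc, h.S_V2, Matrix.zero_mul]
  constraint_ker := h.S_V1
  orthogonal := by rw [aug_sol, transpose_mul, Matrix.mul_assoc, h.V2_V1, Matrix.mul_zero]
  stationary := by
    rw [aug_sol, ← Matrix.mul_assoc D.toRows₂, h.P_V1, h.P_V2, transpose_mul, Matrix.mul_assoc,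
      Matrix.mul_assoc, ← Matrix.mul_assoc h.U1ᵀ, h.U1_U2, Matrix.zero_mul, Matrix.mul_zero]
  below := by
    have hdiag : (diagonal fun j => lam - h.σ2 j ^ 2).PosDef :=
      .diagonal fun j => sub_pos.2 (h2 j)
    have hinj := mulVec_injective_iff_isUnit.2 ((isUnit_nonsing_inv_iff.2 h.isUnit_V22).neg)
    have hform : (diagonal fun j => lam - h.σ2 j ^ 2) =
        h.V2ᵀ * (lam • 1 - D.toRows₂ᵀ * D.toRows₂) * h.V2 := by
      rw [← neg_sub, Matrix.mul_neg, Matrix.neg_mul,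
        transpose_mul_gram_sub_mul h.V2_V2 h.U2_U2 h.P_V2, diagonal_neg]
      simp only [neg_sub]
    rw [hform] at hdiag
    simpa only [conjTranspose_eq_transpose_of_trivial, aug_sol, transpose_mul, Matrix.mul_assoc]
      using hdiag.conjTranspose_mul_mul_same hinj
  above := by
    rw [transpose_mul_gram_sub_mul h.V1_V1 h.U1_U1 h.P_V1]
    exact .diagonal fun i => sub_pos.2 (h1 i)
  spanning := by
    let W := fromRows (fromRows (aug h.sol)ᵀ h.V1ᵀ) D.toRows₁
    have hleft : fromCols (fromCols (-(h.V2 * h.V2.toRows₂ᵀ)) h.V1) h.pinvS * W = 1 := by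
      rw [fromCols_mul_fromRows, fromCols_mul_fromRows, pinvS, Matrix.mul_assoc,
        h.normalizer_mul_S, Matrix.neg_mul, Matrix.mul_assoc, ← transpose_mul, h.aug_sol_mul,
        transpose_neg, Matrix.mul_neg, neg_neg, ← h.complete]
      abel
    have hinj : Function.Injective W.mulVec :=
      Function.LeftInverse.injective (g := (fromCols _ h.pinvS).mulVec) fun v => by
        rw [mulVec_mulVec, hleft, one_mulVec]
    simpa [W, transpose_fromRows, fromCols_mul_fromRows] using PosDef.conjTranspose_mul_self W hinj

end AdaptedSVD

/-! ### The derivative of the solution -/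

theorem Qr_transpose_mul {μ ν κ κ' : Type*} [Fintype μ] [DecidableEq μ] [Fintype ν] [Fintype κ]
    (P : Matrix μ κ ℝ) (Y : Matrix κ ν ℝ) (M : Matrix (ν ⊕ μ) κ' ℝ) :
    (Qr P Y)ᵀ * M = M.toRows₂ - P * Y * M.toRows₁ := by
  conv_lhs => rw [← fromRows_toRows M]
  rw [Qr, transpose_fromRows, fromCols_mul_fromRows, transpose_neg, transpose_transpose,
    transpose_one, Matrix.one_mul, Matrix.neg_mul, neg_add_eq_sub]

namespace AdaptedSVD

variable {ν μ ι τ β : Type*} [Fintype ν] [DecidableEq ν] [Fintype μ] [Fintype ι] [Fintype τ]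
  [DecidableEq τ] [Fintype β] [DecidableEq β] {D : Matrix (ν ⊕ μ) (ι ⊕ τ) ℝ}

/-- The linearization of `system` at the unperturbed solution: `Δ` is the perturbation of the data,
`k` the change of `V₁`, and `Y = [ΔX; 0] V₂₂`, where `ΔX` is the change of the solution. -/
structure IsTangent (h : AdaptedSVD D β) (Δ : Matrix (ν ⊕ μ) (ι ⊕ τ) ℝ) (Y : Matrix (ι ⊕ τ) τ ℝ)
    (k : Matrix (ι ⊕ τ) β ℝ) : Prop where
  lower_eq_zero : Y.toRows₂ = 0
  constraint_sol : D.toRows₁ * Y = Δ.toRows₁ * h.V2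
  stationary : (D.toRows₂ * h.V1)ᵀ * (D.toRows₂ * Y - Δ.toRows₂ * h.V2) =
    (D.toRows₂ * k + Δ.toRows₂ * h.V1)ᵀ * (D.toRows₂ * h.V2)
  orthogonal : h.V2ᵀ * k = Yᵀ * h.V1
  constraint_ker : D.toRows₁ * k = -(Δ.toRows₁ * h.V1)
  normalized : h.V1ᵀ * k = 0

namespace IsTangent

variable {h : AdaptedSVD D β} {Δ : Matrix (ν ⊕ μ) (ι ⊕ τ) ℝ} {Y : Matrix (ι ⊕ τ) τ ℝ}
  {k : Matrix (ι ⊕ τ) β ℝ}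

theorem Vs_mul (t : h.IsTangent Δ Y k) : h.Vsᵀ * Y = h.normalizer * (Δ.toRows₁ * h.V2) := by
  rw [← h.normalizer_mul_S, Matrix.mul_assoc, t.constraint_sol]

theorem P_mul_sub [DecidableEq μ] (t : h.IsTangent Δ Y k) :
    D.toRows₂ * Y - Δ.toRows₂ * h.V2 =
      h.U1 * diagonal h.σ1 * (h.V1ᵀ * Y) + h.U2 * diagonal h.σ2 * (h.V2ᵀ * Y) -
        (Qr D.toRows₂ h.pinvS)ᵀ * (Δ * h.V2) := by
  rw [Qr_transpose_mul, h.P_mul Y, t.constraint_sol]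
  change _ = _ - (Δ.toRows₂ * h.V2 - _ * (Δ.toRows₁ * h.V2))
  abel

theorem P_mul_add [DecidableEq μ] (t : h.IsTangent Δ Y k) :
    D.toRows₂ * k + Δ.toRows₂ * h.V1 =
      h.U2 * diagonal h.σ2 * (Yᵀ * h.V1) + (Qr D.toRows₂ h.pinvS)ᵀ * (Δ * h.V1) := by
  rw [Qr_transpose_mul, h.P_mul k, t.constraint_ker, t.normalized, t.orthogonal, Matrix.mul_zero,
    Matrix.mul_neg]
  change _ = _ + (Δ.toRows₂ * h.V1 - _ * (Δ.toRows₁ * h.V1))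
  abel

theorem sylvester_V1 [DecidableEq μ] (t : h.IsTangent Δ Y k) :
    diagonal h.σ1 ^ 2 * (h.V1ᵀ * Y) - h.V1ᵀ * Y * diagonal h.σ2 ^ 2 =
      diagonal h.σ1 * (h.U1ᵀ * ((Qr D.toRows₂ h.pinvS)ᵀ * (Δ * h.V2))) +
        (Δ * h.V1)ᵀ * Qr D.toRows₂ h.pinvS * h.U2 * diagonal h.σ2 := by
  have hleft : (h.U1 * diagonal h.σ1)ᵀ * (D.toRows₂ * Y - Δ.toRows₂ * h.V2) =
      diagonal h.σ1 ^ 2 * (h.V1ᵀ * Y) -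
        diagonal h.σ1 * (h.U1ᵀ * ((Qr D.toRows₂ h.pinvS)ᵀ * (Δ * h.V2))) := by
    rw [t.P_mul_sub, transpose_mul, diagonal_transpose, Matrix.mul_sub, Matrix.mul_add,
      Matrix.mul_assoc (diagonal h.σ1), Matrix.mul_assoc (diagonal h.σ1),
      Matrix.mul_assoc h.U1, ← Matrix.mul_assoc h.U1ᵀ, h.U1_U1,
      Matrix.mul_assoc h.U2, ← Matrix.mul_assoc h.U1ᵀ, h.U1_U2]
    simp only [sq, Matrix.mul_assoc, Matrix.one_mul, Matrix.zero_mul, Matrix.mul_zero, add_zero]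
  have hright : (D.toRows₂ * k + Δ.toRows₂ * h.V1)ᵀ * (h.U2 * diagonal h.σ2) =
      h.V1ᵀ * Y * diagonal h.σ2 ^ 2 +
        (Δ * h.V1)ᵀ * Qr D.toRows₂ h.pinvS * h.U2 * diagonal h.σ2 := by
    have hU : h.U2ᵀ * (h.U2 * diagonal h.σ2) = diagonal h.σ2 := by
      rw [← Matrix.mul_assoc, h.U2_U2, Matrix.one_mul]
    rw [t.P_mul_add, transpose_add, Matrix.add_mul]
    simp only [transpose_mul, transpose_transpose, diagonal_transpose, Matrix.mul_assoc, sq, hU]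
  have hst := t.stationary
  rw [h.P_V1, h.P_V2, hleft, hright] at hst
  rw [sub_eq_iff_eq_add.1 hst]
  abel

theorem V1_mul_eq_zero (t : h.IsTangent 0 Y k) : h.V1ᵀ * Y = 0 := by
  classical
  have hsylv : diagonal h.σ1 ^ 2 * (h.V1ᵀ * Y) - h.V1ᵀ * Y * diagonal h.σ2 ^ 2 = 0 := by
    simpa using t.sylvester_V1
  ext i j
  have hij : (h.σ1 i ^ 2 - h.σ2 j ^ 2) * (h.V1ᵀ * Y) i j = 0 := by
    have := congrFun (congrFun hsylv i) j
    rw [diagonal_pow, diagonal_pow, Matrix.sub_apply, diagonal_mul, mul_diagonal] at this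
    rw [sub_mul, mul_comm (h.σ2 j ^ 2)]
    exact this
  exact (mul_eq_zero.1 hij).resolve_left (sub_pos.2 (h.sq_lt_sq i j)).ne'

theorem eq_zero [Finite ι] (t : h.IsTangent 0 Y k) : Y = 0 ∧ k = 0 := by
  have hrows : (0 : Matrix (ν ⊕ μ) (ι ⊕ τ) ℝ).toRows₁ = 0 := rfl
  have hY : Y = h.V2 * (h.V2ᵀ * Y) := by
    refine h.ext_of_mul_eq ?_ ?_ ?_
    · rw [t.Vs_mul, ← Matrix.mul_assoc h.Vsᵀ, h.Vs_V2, hrows, Matrix.zero_mul, Matrix.zero_mul,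
        Matrix.mul_zero]
    · rw [t.V1_mul_eq_zero, ← Matrix.mul_assoc, h.V1_V2, Matrix.zero_mul]
    · rw [← Matrix.mul_assoc h.V2ᵀ h.V2, h.V2_V2, Matrix.one_mul]
  have hcoord : h.V2ᵀ * Y = 0 := by
    refine h.isUnit_V22.mul_right_eq_zero.1 ?_
    rw [← t.lower_eq_zero]
    conv_rhs => rw [hY]
    rfl
  have hY0 : Y = 0 := by rw [hY, hcoord, Matrix.mul_zero]
  refine ⟨hY0, h.ext_of_mul_eq ?_ ?_ ?_⟩
  · rw [← h.normalizer_mul_S, Matrix.mul_assoc, t.constraint_ker, hrows, Matrix.zero_mul, neg_zero,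
      Matrix.mul_zero, Matrix.mul_zero]
  · rw [t.normalized, Matrix.mul_zero]
  · rw [t.orthogonal, hY0, transpose_zero, Matrix.zero_mul, Matrix.mul_zero]

end IsTangent

theorem isTangent_of_fderiv_system_eq_zero (h : AdaptedSVD D β) {Δ : Matrix (ν ⊕ μ) (ι ⊕ τ) ℝ}
    {ΔX : Matrix ι τ ℝ} {k : Matrix (ι ⊕ τ) β ℝ}
    (heq : (D.toRows₁ * fromRows ΔX (0 : Matrix τ τ ℝ) + Δ.toRows₁ * aug h.sol,
      (D.toRows₂ * h.V1)ᵀ * (D.toRows₂ * fromRows ΔX (0 : Matrix τ τ ℝ) + Δ.toRows₂ * aug h.sol) +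
        (D.toRows₂ * k + Δ.toRows₂ * h.V1)ᵀ * (D.toRows₂ * aug h.sol),
      (aug h.sol)ᵀ * k + (fromRows ΔX (0 : Matrix τ τ ℝ))ᵀ * h.V1,
      D.toRows₁ * k + Δ.toRows₁ * h.V1, h.V1ᵀ * k) = 0) :
    h.IsTangent Δ (fromRows ΔX (0 : Matrix τ τ ℝ) * h.V2.toRows₂) k := by
  simp only [Prod.ext_iff, Prod.fst_zero, Prod.snd_zero] at heq
  obtain ⟨h1, h2, h3, h4, h5⟩ := heq
  have h1' := congrArg (· * h.V2.toRows₂) h1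
  have h2' := congrArg (· * h.V2.toRows₂) h2
  have h3' := congrArg (h.V2.toRows₂ᵀ * ·) h3
  simp only [Matrix.add_mul, Matrix.mul_assoc, h.aug_sol_mul, Matrix.mul_neg, Matrix.zero_mul,
    ← sub_eq_add_neg, sub_eq_zero] at h1' h2'
  simp only [Matrix.mul_add, ← Matrix.mul_assoc, ← transpose_mul, h.aug_sol_mul, Matrix.mul_zero,
    transpose_neg, Matrix.neg_mul, neg_add_eq_sub, sub_eq_zero] at h3'
  exact
    { lower_eq_zero := by rw [fromRows_mul, Matrix.zero_mul]; rfl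
      constraint_sol := h1'
      stationary := h2'
      orthogonal := h3'.symm
      constraint_ker := eq_neg_of_add_eq_zero_left h4
      normalized := h5 }

end AdaptedSVD

theorem IsCertificate.system_eq_zero {ν μ ι τ β : Type*} [Fintype ν] [Fintype μ] [Fintype ι]
    [DecidableEq ι] [Fintype τ] [DecidableEq τ] [Fintype β] [DecidableEq β]
    {D : Matrix (ν ⊕ μ) (ι ⊕ τ) ℝ} {lam : ℝ} {X : Matrix ι τ ℝ} {K : Matrix (ι ⊕ τ) β ℝ}
    (h : IsCertificate D lam X K) {V : Matrix (ι ⊕ τ) β ℝ} (hV : Vᵀ * K = 1) :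
    system V (D, X, K) = 0 := by
  rw [system, h.constraint_aug, h.stationary, h.orthogonal, h.constraint_ker, hV, sub_self]
  rfl

open scoped Matrix.Norms.Frobenius in
theorem AdaptedSVD.exists_solution_map {ν μ ι τ β : Type*} [Fintype ν] [DecidableEq ν] [Fintype μ]
    [Fintype ι] [Fintype τ] [DecidableEq τ] [Fintype β] [DecidableEq β]
    {D : Matrix (ν ⊕ μ) (ι ⊕ τ) ℝ} (h : AdaptedSVD D β) :
    ∃ (φ : Matrix (ν ⊕ μ) (ι ⊕ τ) ℝ → Matrix ι τ ℝ)
      (L : Matrix (ν ⊕ μ) (ι ⊕ τ) ℝ →L[ℝ] Matrix ι τ ℝ),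
      HasFDerivAt φ L D ∧ (∀ᶠ D' in 𝓝 D, ∀ X, IsTLSESol D' X ↔ X = φ D') ∧
      ∀ Δ, ∃ k, h.IsTangent Δ (fromRows (L Δ) (0 : Matrix τ τ ℝ) * h.V2.toRows₂) k := by
  classical
  obtain ⟨lam, h2, h1⟩ := h.exists_between_sq
  have hcert := h.isCertificate h2 h1
  obtain ⟨F', hF, hF'⟩ := exists_hasStrictFDerivAt_system h.V1 D h.sol h.V1
  obtain ⟨ψ, ψ', hψ, hψD, hzero, hker⟩ := exists_implicit_function
    (finrank_unknowns_eq_finrank_equations τ h.card_eq) hF (hcert.system_eq_zero h.V1_V1) (by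
      rintro ⟨ΔX, k⟩ h0
      obtain ⟨hX, hk⟩ := (h.isTangent_of_fderiv_system_eq_zero ((hF' 0 ΔX k).symm.trans h0)).eq_zero
      obtain ⟨_⟩ := h.isUnit_V22.nonempty_invertible
      rw [← Matrix.zero_mul (l := ι ⊕ τ) h.V2.toRows₂, Matrix.mul_left_inj_of_invertible] at hX
      exact Prod.ext (congrArg toRows₁ hX) hk)
  have hcont : Tendsto (fun D' => (D', ψ D')) (𝓝 D) (𝓝 (D, h.sol, h.V1)) := by
    rw [← hψD]
    exact (continuousAt_id.prodMk hψ.hasFDerivAt.continuousAt).tendsto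
  refine ⟨fun D' => (ψ D').1, .fst ℝ _ _ ∘L ψ', hψ.hasFDerivAt.fst, ?_,
    fun Δ => ⟨(ψ' Δ).2, h.isTangent_of_fderiv_system_eq_zero ((hF' Δ _ _).symm.trans (hker Δ))⟩⟩
  filter_upwards [hcont.eventually (hcert.eventually h.V1), hzero] with D' hD' hzero' X
  exact (hD' hzero').isTLSESol_iff_eq

theorem fromRows_add_fromRows {l m n : Type*} (M M' : Matrix l n ℝ) (Z Z' : Matrix m n ℝ) :
    fromRows M Z + fromRows M' Z' = fromRows (M + M') (Z + Z') := by
  ext (i | i) j <;> rfl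

/-- The projection of `ν ⊕ β` coordinates onto the `β` coordinates. -/
def lowerProj (ν β : Type*) [DecidableEq β] : Matrix (ν ⊕ β) (ν ⊕ β) ℝ := fromBlocks 0 0 0 1

namespace AdaptedSVD

variable {ν μ ι τ β : Type*} [Fintype ν] [DecidableEq ν] [Fintype μ] [Fintype ι] [Fintype τ]
  [DecidableEq τ] [Fintype β] [DecidableEq β] {D : Matrix (ν ⊕ μ) (ι ⊕ τ) ℝ}

/-- The orthonormal basis `[V_s, V₁]` of the orthogonal complement of the columns of `[X; -I]`. -/
def W (h : AdaptedSVD D β) : Matrix (ι ⊕ τ) (ν ⊕ β) ℝ := fromCols h.Vs h.V1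

/-- The left singular vectors that go with the columns of `W`. -/
def T (h : AdaptedSVD D β) : Matrix (ν ⊕ μ) (ν ⊕ β) ℝ := fromBlocks h.Us 0 0 h.U1

theorem W_transpose_mul {α : Type*} (h : AdaptedSVD D β) (M : Matrix (ι ⊕ τ) α ℝ) :
    h.Wᵀ * M = fromRows (h.Vsᵀ * M) (h.V1ᵀ * M) := by
  rw [W, transpose_fromCols, fromRows_mul]

theorem T_transpose_mul {α : Type*} (h : AdaptedSVD D β) (M : Matrix (ν ⊕ μ) α ℝ) :
    h.Tᵀ * M = fromRows (h.Usᵀ * M.toRows₁) (h.U1ᵀ * M.toRows₂) := by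
  conv_lhs => rw [← fromRows_toRows M]
  simp only [T, fromBlocks_transpose, transpose_zero, fromBlocks_mul_fromRows, Matrix.zero_mul,
    add_zero, zero_add]

theorem W_transpose_mul_W (h : AdaptedSVD D β) : h.Wᵀ * h.W = 1 := by
  rw [W_transpose_mul, W, mul_fromCols, mul_fromCols, h.Vs_Vs, h.Vs_V1, h.V1_Vs, h.V1_V1,
    fromRows_fromCols_eq_fromBlocks, fromBlocks_one]

theorem W_transpose_mul_V2 (h : AdaptedSVD D β) : h.Wᵀ * h.V2 = 0 := by
  rw [W_transpose_mul, h.Vs_V2, h.V1_V2, fromRows_zero]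

theorem W_mul_transpose [DecidableEq ι] (h : AdaptedSVD D β) :
    h.W * h.Wᵀ + h.V2 * h.V2ᵀ = 1 := by
  rw [W, transpose_fromCols, fromCols_mul_fromRows, h.complete]

theorem T_transpose_mul_T (h : AdaptedSVD D β) : h.Tᵀ * h.T = 1 := by
  rw [T, fromBlocks_transpose, fromBlocks_multiply]
  simp [h.Us_Us, h.U1_U1]

/-- The singular values that go with the columns of `W`. -/
def S (h : AdaptedSVD D β) : Matrix (ν ⊕ β) (ν ⊕ β) ℝ :=
  fromBlocks (diagonal h.s) 0 0 (diagonal h.σ1)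

/-- The effect on the `T`-coordinates of eliminating the constraints from `P`. -/
noncomputable def N (h : AdaptedSVD D β) : Matrix (ν ⊕ β) (ν ⊕ β) ℝ :=
  fromBlocks 1 0 (-(h.U1ᵀ * (D.toRows₂ * h.pinvS) * h.Us)) 1

theorem N_mul_T_transpose_mul [DecidableEq μ] {α : Type*} (h : AdaptedSVD D β)
    (M : Matrix (ν ⊕ μ) α ℝ) :
    h.N * (h.Tᵀ * M) = fromRows (h.Usᵀ * M.toRows₁)
      (h.U1ᵀ * ((Qr D.toRows₂ h.pinvS)ᵀ * M)) := by
  have hUs : h.Us * (h.Usᵀ * M.toRows₁) = M.toRows₁ := by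
    rw [← Matrix.mul_assoc, mul_eq_one_comm.1 h.Us_Us, Matrix.one_mul]
  rw [N, T_transpose_mul, fromBlocks_mul_fromRows, Qr_transpose_mul, Matrix.one_mul,
    Matrix.zero_mul, add_zero, Matrix.one_mul, Matrix.neg_mul, Matrix.mul_assoc _ h.Us, hUs,
    Matrix.mul_assoc, neg_add_eq_sub, Matrix.mul_sub]

theorem IsTangent.diagonal_s_mul {h : AdaptedSVD D β} {Δ : Matrix (ν ⊕ μ) (ι ⊕ τ) ℝ}
    {Y : Matrix (ι ⊕ τ) τ ℝ} {k : Matrix (ι ⊕ τ) β ℝ} (t : h.IsTangent Δ Y k) :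
    diagonal h.s * (h.Vsᵀ * Y) = h.Usᵀ * (Δ * h.V2).toRows₁ := by
  calc diagonal h.s * (h.Vsᵀ * Y) = h.Usᵀ * h.Us * diagonal h.s * (h.Vsᵀ * Y) := by
        rw [h.Us_Us, Matrix.one_mul]
    _ = h.Usᵀ * (D.toRows₁ * Y) := by rw [h.S_eq]; simp only [Matrix.mul_assoc]
    _ = _ := by rw [t.constraint_sol]; rfl

theorem IsTangent.sylvester [DecidableEq μ] {h : AdaptedSVD D β} {Δ : Matrix (ν ⊕ μ) (ι ⊕ τ) ℝ}
    {Y : Matrix (ι ⊕ τ) τ ℝ} {k : Matrix (ι ⊕ τ) β ℝ} (t : h.IsTangent Δ Y k) :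
    h.S ^ 2 * (h.Wᵀ * Y) - lowerProj ν β * (h.Wᵀ * Y) * ((diagonal h.σ2)ᵀ * diagonal h.σ2) =
      lowerProj ν β * ((Δ * h.W)ᵀ * Qr D.toRows₂ h.pinvS * h.U2) * diagonal h.σ2 +
        h.S * (h.N * (h.Tᵀ * (Δ * h.V2))) := by
  have hW : (Δ * h.W)ᵀ * Qr D.toRows₂ h.pinvS * h.U2 =
      fromRows ((Δ * h.Vs)ᵀ * Qr D.toRows₂ h.pinvS * h.U2)
        ((Δ * h.V1)ᵀ * Qr D.toRows₂ h.pinvS * h.U2) := by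
    rw [W, mul_fromCols, transpose_fromCols, fromRows_mul, fromRows_mul]
  rw [sub_eq_iff_eq_add]
  simp only [hW, N_mul_T_transpose_mul, W_transpose_mul, S, lowerProj, sq,
    Matrix.mul_assoc (fromBlocks _ _ _ _) (fromBlocks _ _ _ _) (fromRows _ _),
    fromBlocks_mul_fromRows, fromRows_mul, Matrix.zero_mul, Matrix.one_mul, zero_add, add_zero,
    fromRows_add_fromRows, t.diagonal_s_mul]
  congr 1
  have := sub_eq_iff_eq_add.1 t.sylvester_V1
  simp only [sq, Matrix.mul_assoc, diagonal_transpose] at this ⊢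
  rw [this]
  abel

end AdaptedSVD

/-! ### The derivative in coordinates -/

theorem permMatrix_mulVec_vec {d n : ℕ} (M : Matrix (Fin d) (Fin n) ℝ) :
    permMatrix d n *ᵥ M.vec = Mᵀ.vec := by
  simp only [permMatrix, Matrix.sum_mulVec, kronecker_mulVec_vec]
  funext ⟨i, j⟩
  simp only [Finset.sum_apply, vec, transpose_single, single_mul_mul_single]
  simp [single_apply, ite_and]

theorem Hr_mulVec_vec {n d : ℕ} (V : Matrix (Fin d) (Fin d) ℝ) (W : Matrix (Fin n) (Fin n) ℝ)
    (M : Matrix (Fin d) (Fin n) ℝ) : Hr V W *ᵥ M.vec = ((W⁻¹)ᵀ * Mᵀ * V⁻¹).vec := by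
  rw [Hr, ← mulVec_mulVec, permMatrix_mulVec_vec, kronecker_mulVec_vec, transpose_transpose]

theorem Gr_mul_Zr_mulVec {a b n d : ℕ} (hn : n = a + b) {μ ν κ : Type*} [Fintype μ]
    [DecidableEq μ] [Fintype ν] [Fintype κ] {S : Matrix (Fin n) (Fin n) ℝ}
    {Sig : Matrix (Fin d) (Fin d) ℝ}
    (hunit : IsUnit ((S ^ 2) ⊗ₖ (1 : Matrix (Fin d) (Fin d) ℝ) -
      block hn 0 0 0 1 ⊗ₖ (Sigᵀ * Sig)).det)
    {P : Matrix μ κ ℝ} {Y : Matrix κ ν ℝ} {Us : Matrix ν (Fin a) ℝ} {U1 : Matrix μ (Fin b) ℝ}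
    {U2 : Matrix μ (Fin d) ℝ} {c M : Matrix (Fin n) (Fin d) ℝ} {R : Matrix (ν ⊕ μ) (Fin n) ℝ}
    (hc : S ^ 2 * c - block hn 0 0 0 1 * c * (Sigᵀ * Sig) =
      block hn 0 0 0 1 * (Rᵀ * Qr P Y * U2) * Sig +
        S * (block hn 1 0 (-(U1ᵀ * (P * Y) * Us)) 1 * M)) :
    (Gr hn S Sig * Zr hn P Y Us U1 U2) *ᵥ Sum.elim R.vec Mᵀ.vec = cᵀ.vec := by
  have hlhs : ((S ^ 2) ⊗ₖ (1 : Matrix (Fin d) (Fin d) ℝ) - block hn 0 0 0 1 ⊗ₖ (Sigᵀ * Sig)) *ᵥ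
      cᵀ.vec = (S ^ 2 * c - block hn 0 0 0 1 * c * (Sigᵀ * Sig))ᵀ.vec := by
    simp only [sub_mulVec, kronecker_mulVec_vec, transpose_mul, transpose_transpose, transpose_sub,
      vec_sub, Matrix.one_mul, Matrix.mul_assoc]
  have hrhs : fromCols ((1 : Matrix (Fin n) (Fin n) ℝ) ⊗ₖ Sigᵀ)
      (S ⊗ₖ (1 : Matrix (Fin d) (Fin d) ℝ)) *ᵥ
        (Zr hn P Y Us U1 U2 *ᵥ Sum.elim R.vec Mᵀ.vec) =
      (block hn 0 0 0 1 * (Rᵀ * Qr P Y * U2) * Sig +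
        S * (block hn 1 0 (-(U1ᵀ * (P * Y) * Us)) 1 * M))ᵀ.vec := by
    simp only [Zr, fromBlocks_mulVec, Sum.elim_comp_inl, Sum.elim_comp_inr, zero_mulVec, add_zero,
      zero_add, fromCols_mulVec_sumElim, kronecker_mulVec_vec, transpose_one, Matrix.mul_one,
      Matrix.one_mul, transpose_mul, transpose_transpose, transpose_add, vec_add,
      Matrix.mul_assoc]
  rw [← mulVec_mulVec, Gr, ← mulVec_mulVec, hrhs, ← hc, ← hlhs,
    mulVec_mulVec, nonsing_inv_mul _ hunit, one_mulVec]

theorem block_mul_submatrix {a b n : ℕ} (hn : n = a + b) {α : Type*}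
    (M₁₁ : Matrix (Fin a) (Fin a) ℝ) (M₁₂ : Matrix (Fin a) (Fin b) ℝ)
    (M₂₁ : Matrix (Fin b) (Fin a) ℝ) (M₂₂ : Matrix (Fin b) (Fin b) ℝ)
    (M : Matrix (Fin a ⊕ Fin b) α ℝ) :
    block hn M₁₁ M₁₂ M₂₁ M₂₂ * M.submatrix (blockEquiv hn).symm id =
      (fromBlocks M₁₁ M₁₂ M₂₁ M₂₂ * M).submatrix (blockEquiv hn).symm id :=
  submatrix_mul_equiv _ _ _ _ _

/-- The coordinates of a data perturbation on which the first-order change of the solution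
depends. -/
def coords {ρ κ ι τ : Type*} [Fintype ρ] [Fintype κ] (W : Matrix κ ι ℝ) (V : Matrix κ τ ℝ)
    (T : Matrix ρ ι ℝ) (Δ : Matrix ρ κ ℝ) : (ι × ρ) ⊕ (ι × τ) → ℝ :=
  Sum.elim (Δ * W).vec (Tᵀ * (Δ * V))ᵀ.vec

namespace AdaptedSVD

theorem fromCols_sol_mul_W {ν μ ι τ β : Type*} [Fintype ν] [DecidableEq ν] [Fintype μ] [Fintype ι]
    [DecidableEq ι] [Fintype τ] [DecidableEq τ] [Fintype β] [DecidableEq β]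
    {D : Matrix (ν ⊕ μ) (ι ⊕ τ) ℝ} (h : AdaptedSVD D β) :
    fromCols (1 : Matrix ι ι ℝ) h.sol * h.W * h.W.toRows₁ᵀ = 1 := by
  have hW : h.W.toRows₁ᵀ = h.Wᵀ * fromRows (1 : Matrix ι ι ℝ) (0 : Matrix τ ι ℝ) := by
    conv_rhs => rw [← fromRows_toRows h.W, transpose_fromRows, fromCols_mul_fromRows,
      Matrix.mul_one, Matrix.mul_zero, add_zero]
  have hV2 : fromCols (1 : Matrix ι ι ℝ) h.sol * h.V2 = 0 := by
    have hV22 := nonsing_inv_mul _ ((isUnit_iff_isUnit_det _).1 h.isUnit_V22)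
    conv_lhs => rw [← fromRows_toRows h.V2]
    rw [fromCols_mul_fromRows, Matrix.one_mul, sol, Matrix.neg_mul, Matrix.mul_assoc, hV22,
      Matrix.mul_one, add_neg_cancel]
  rw [hW, ← Matrix.mul_assoc, Matrix.mul_assoc _ h.W, eq_sub_of_add_eq h.W_mul_transpose,
    Matrix.mul_sub, Matrix.mul_one, ← Matrix.mul_assoc, hV2, Matrix.zero_mul, sub_zero,
    fromCols_mul_fromRows, Matrix.mul_one, Matrix.mul_zero, add_zero]

variable {a b n d : ℕ} {μ : Type*} [Fintype μ]
  {D : Matrix (Fin a ⊕ μ) (Fin n ⊕ Fin d) ℝ}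

theorem transpose_inv_W1 (h : AdaptedSVD D (Fin b)) (hn : n = a + b) :
    ((W1 hn h.Vs h.V1)⁻¹)ᵀ * (W1 hn h.Vs h.V1)ᵀ = 1 := by
  rw [transpose_nonsing_inv]
  refine nonsing_inv_mul _ ((isUnit_iff_isUnit_det _).1 ?_)
  refine IsUnit.of_mul_eq_one_right
    ((fromCols (1 : Matrix (Fin n) (Fin n) ℝ) h.sol * h.W).submatrix id (blockEquiv hn).symm) ?_
  refine (submatrix_mul_equiv _ h.W.toRows₁ᵀ id (blockEquiv hn).symm id).trans ?_
  rw [h.fromCols_sol_mul_W, submatrix_id_id]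

theorem isUnit_det_sylvester (h : AdaptedSVD D (Fin b)) (hn : n = a + b) :
    IsUnit ((block hn (diagonal h.s) 0 0 (diagonal h.σ1) ^ 2) ⊗ₖ (1 : Matrix (Fin d) (Fin d) ℝ) -
      block hn 0 0 0 1 ⊗ₖ ((diagonal h.σ2)ᵀ * diagonal h.σ2)).det := by
  have hblock : ∀ (x : Fin a → ℝ) (y : Fin b → ℝ), block hn (diagonal x) 0 0 (diagonal y) =
      diagonal (Sum.elim x y ∘ (blockEquiv hn).symm) := fun x y => by
    rw [block, reindex_apply, fromBlocks_diagonal, submatrix_diagonal_equiv]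
  have hE := hblock 0 1
  rw [diagonal_zero', diagonal_one'] at hE
  rw [hE, hblock, diagonal_pow, ← diagonal_one, diagonal_kronecker_diagonal,
    diagonal_transpose, diagonal_mul_diagonal, diagonal_kronecker_diagonal, diagonal_sub,
    det_diagonal, isUnit_iff_ne_zero, Finset.prod_ne_zero_iff]
  rintro ⟨i, j⟩ -
  obtain ⟨i | i, rfl⟩ := (blockEquiv hn).surjective i
  · simpa using h.s_ne i
  · simpa [sub_eq_zero, ← sq] using (h.sq_lt_sq i j).ne'

theorem IsTangent.mulVec_coords [DecidableEq μ] {h : AdaptedSVD D (Fin b)} (hn : n = a + b)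
    {Δ : Matrix (Fin a ⊕ μ) (Fin n ⊕ Fin d) ℝ} {ΔX : Matrix (Fin n) (Fin d) ℝ}
    {k : Matrix (Fin n ⊕ Fin d) (Fin b) ℝ}
    (t : h.IsTangent Δ (fromRows ΔX (0 : Matrix (Fin d) (Fin d) ℝ) * h.V2.toRows₂) k) :
    (Hr h.V2.toRows₂ (W1 hn h.Vs h.V1) *
      Gr hn (block hn (diagonal h.s) 0 0 (diagonal h.σ1)) (diagonal h.σ2) *
      Zr hn D.toRows₂ h.pinvS h.Us h.U1 h.U2) *ᵥ
        coords (h.W.submatrix id (blockEquiv hn).symm) h.V2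
          (h.T.submatrix id (blockEquiv hn).symm) Δ = ΔX.vec := by
  have hc : h.Wᵀ * (fromRows ΔX (0 : Matrix (Fin d) (Fin d) ℝ) * h.V2.toRows₂) =
      h.W.toRows₁ᵀ * (ΔX * h.V2.toRows₂) := by
    conv_lhs => rw [← fromRows_toRows h.W, transpose_fromRows, fromRows_mul, Matrix.zero_mul,
      fromCols_mul_fromRows, Matrix.mul_zero, add_zero]
  have hsylv := congrArg (·.submatrix (blockEquiv hn).symm id) t.sylvester
  rw [hc, sq, Matrix.mul_assoc h.S] at hsylv
  have hV22 := mul_nonsing_inv _ ((isUnit_iff_isUnit_det _).1 h.isUnit_V22)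
  rw [Matrix.mul_assoc, ← mulVec_mulVec, coords, Gr_mul_Zr_mulVec hn (h.isUnit_det_sylvester hn)
    (c := (h.W.toRows₁ᵀ * (ΔX * h.V2.toRows₂)).submatrix (blockEquiv hn).symm id), Hr_mulVec_vec,
    transpose_transpose]
  · change (((W1 hn h.Vs h.V1)⁻¹)ᵀ * ((W1 hn h.Vs h.V1)ᵀ * (ΔX * h.V2.toRows₂)) *
      h.V2.toRows₂⁻¹).vec = _
    rw [← Matrix.mul_assoc, h.transpose_inv_W1, Matrix.one_mul, Matrix.mul_assoc, hV22,
      Matrix.mul_one]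
  · change _ = block hn 0 0 0 1 *
      ((Δ * h.W)ᵀ * Qr D.toRows₂ h.pinvS * h.U2).submatrix (blockEquiv hn).symm id * _ +
        _ * (_ * (h.Tᵀ * (Δ * h.V2)).submatrix (blockEquiv hn).symm id)
    rw [sq, Matrix.mul_assoc (block hn _ _ _ _)]
    simp only [block_mul_submatrix]
    exact hsylv

end AdaptedSVD

/-! ### The norm of the derivative -/

section SpectralNorm

variable {m n : Type*} [Fintype m] [Fintype n]

theorem norm_toLp_vec (A : Matrix m n ℝ) : ‖WithLp.toLp 2 A.vec‖ = frob A := by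
  rw [EuclideanSpace.norm_eq, frob_eq_sqrt, Fintype.sum_prod_type, Finset.sum_comm]
  simp only [vec, Real.norm_eq_abs, sq_abs]

theorem norm_toLp_sumElim_sq (v : m → ℝ) (w : n → ℝ) :
    ‖WithLp.toLp 2 (Sum.elim v w)‖ ^ 2 = ‖WithLp.toLp 2 v‖ ^ 2 + ‖WithLp.toLp 2 w‖ ^ 2 := by
  simp only [EuclideanSpace.norm_sq_eq, Fintype.sum_sum_type, Sum.elim_inl, Sum.elim_inr]

variable [DecidableEq n]

open scoped Matrix.Norms.L2Operator in
theorem isLeast_specNorm {E G : Type*} [Norm E] [Norm G] {L : E → G}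
    {A : Matrix m n ℝ} {z : E → n → ℝ} (hL : ∀ x, ‖L x‖ = ‖WithLp.toLp 2 (A *ᵥ z x)‖)
    (hz : ∀ x, ‖WithLp.toLp 2 (z x)‖ ≤ ‖x‖) (hz' : ∀ w, ∃ x, z x = w ∧ ‖x‖ = ‖WithLp.toLp 2 w‖) :
    IsLeast {c | 0 ≤ c ∧ ∀ x, ‖L x‖ ≤ c * ‖x‖} (specNorm A) := by
  refine ⟨⟨norm_nonneg A, fun x => ?_⟩, fun c ⟨hc, hcL⟩ => ?_⟩
  · rw [hL]
    exact (A.l2_opNorm_mulVec (WithLp.toLp 2 (z x))).trans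
      (mul_le_mul_of_nonneg_left (hz x) (norm_nonneg A))
  · rw [specNorm, l2_opNorm_def]
    refine ContinuousLinearMap.opNorm_le_bound _ hc fun w => ?_
    obtain ⟨x, hx, hxw⟩ := hz' w.ofLp
    have hLx := hcL x
    rw [hL, hx, hxw] at hLx
    exact hLx

end SpectralNorm

section Coisometry

variable {ρ κ ι τ : Type*} [Fintype ρ] [Fintype κ] [Fintype ι] [Fintype τ]

theorem frob_transpose (M : Matrix ρ κ ℝ) : frob Mᵀ = frob M := by
  rw [frob_eq_sqrt, frob_eq_sqrt, Finset.sum_comm]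
  rfl

theorem norm_coords_sq (W : Matrix κ ι ℝ) (V : Matrix κ τ ℝ) (T : Matrix ρ ι ℝ)
    (Δ : Matrix ρ κ ℝ) :
    ‖WithLp.toLp 2 (coords W V T Δ)‖ ^ 2 = frob (Δ * W) ^ 2 + frob (Tᵀ * (Δ * V)) ^ 2 := by
  rw [coords, norm_toLp_sumElim_sq, norm_toLp_vec, norm_toLp_vec, frob_transpose]

theorem frob_mul_sq (Δ : Matrix ρ κ ℝ) (V : Matrix κ τ ℝ) :
    frob (Δ * V) ^ 2 = (Δᵀ * Δ * (V * Vᵀ)).trace := by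
  rw [frob_sq, transpose_mul, Matrix.mul_assoc, trace_mul_comm]
  simp only [Matrix.mul_assoc]

theorem frob_sq_eq_add [DecidableEq κ] {W : Matrix κ ι ℝ} {V : Matrix κ τ ℝ}
    (h : W * Wᵀ + V * Vᵀ = 1) (Δ : Matrix ρ κ ℝ) :
    frob Δ ^ 2 = frob (Δ * W) ^ 2 + frob (Δ * V) ^ 2 := by
  rw [frob_mul_sq, frob_mul_sq, ← trace_add, ← Matrix.mul_add, h, Matrix.mul_one, frob_sq]

variable [DecidableEq ι] {T : Matrix ρ ι ℝ} (hT : Tᵀ * T = 1)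
include hT

theorem frob_isometry_mul_sq (M : Matrix ι τ ℝ) : frob (T * M) ^ 2 = frob M ^ 2 := by
  rw [frob_sq, frob_sq, transpose_mul, Matrix.mul_assoc, ← Matrix.mul_assoc Tᵀ, hT,
    Matrix.one_mul]

theorem frob_transpose_isometry_mul_sq_le (M : Matrix ρ τ ℝ) :
    frob (Tᵀ * M) ^ 2 ≤ frob M ^ 2 := by
  have hproj : Tᵀ * (T * (Tᵀ * M)) = Tᵀ * M := by rw [← Matrix.mul_assoc, hT, Matrix.one_mul]
  have hpyth : frob (M - T * (Tᵀ * M)) ^ 2 = frob M ^ 2 - frob (Tᵀ * M) ^ 2 := by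
    simp only [frob_sq, ← trace_sub, transpose_sub, transpose_mul, transpose_transpose,
      Matrix.sub_mul, Matrix.mul_sub, Matrix.mul_assoc, hproj, sub_self, sub_zero]
  linarith [sq_nonneg (frob (M - T * (Tᵀ * M)))]

variable [DecidableEq κ] {W : Matrix κ ι ℝ} {V : Matrix κ τ ℝ} (hWV : W * Wᵀ + V * Vᵀ = 1)
include hWV

theorem norm_coords_le (Δ : Matrix ρ κ ℝ) : ‖WithLp.toLp 2 (coords W V T Δ)‖ ≤ frob Δ := by
  rw [← sq_le_sq₀ (norm_nonneg _) (frob_nonneg _), norm_coords_sq, frob_sq_eq_add hWV]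
  exact add_le_add le_rfl (frob_transpose_isometry_mul_sq_le hT (Δ * V))

theorem exists_coords_eq [DecidableEq τ] (hW : Wᵀ * W = 1) (hWV0 : Wᵀ * V = 0)
    (hV : Vᵀ * V = 1) (w : (ι × ρ) ⊕ (ι × τ) → ℝ) :
    ∃ Δ, coords W V T Δ = w ∧ frob Δ = ‖WithLp.toLp 2 w‖ := by
  obtain ⟨R, hR⟩ := (vec_bijective (R := ℝ)).2 (w ∘ Sum.inl)
  obtain ⟨Z, hZ⟩ := (vec_bijective (R := ℝ)).2 (w ∘ Sum.inr)
  have hVW : Vᵀ * W = 0 := by simpa using congrArg transpose hWV0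
  have hΔW : (R * Wᵀ + T * Zᵀ * Vᵀ) * W = R := by
    rw [Matrix.add_mul, Matrix.mul_assoc, hW, Matrix.mul_assoc _ Vᵀ, hVW, Matrix.mul_one,
      Matrix.mul_zero, add_zero]
  have hΔV : (R * Wᵀ + T * Zᵀ * Vᵀ) * V = T * Zᵀ := by
    rw [Matrix.add_mul, Matrix.mul_assoc, hWV0, Matrix.mul_assoc _ Vᵀ, hV, Matrix.mul_one,
      Matrix.mul_zero, zero_add]
  have hTZ : Tᵀ * (T * Zᵀ) = Zᵀ := by rw [← Matrix.mul_assoc, hT, Matrix.one_mul]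
  have hw : coords W V T (R * Wᵀ + T * Zᵀ * Vᵀ) = w := by
    rw [coords, hΔW, hΔV, hTZ, transpose_transpose, hR, hZ, Sum.elim_comp_inl_inr]
  refine ⟨_, hw, ?_⟩
  rw [← sq_eq_sq₀ (frob_nonneg _) (norm_nonneg _), ← hw, norm_coords_sq, frob_sq_eq_add hWV, hΔV,
    hTZ, frob_isometry_mul_sq hT]

end Coisometry

open scoped Matrix.Norms.Frobenius in
theorem AdaptedSVD.isLeast_specNorm {a b n d : ℕ} {μ : Type*} [Fintype μ] [DecidableEq μ]
    {D : Matrix (Fin a ⊕ μ) (Fin n ⊕ Fin d) ℝ} (h : AdaptedSVD D (Fin b)) (hn : n = a + b)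
    {L : Matrix (Fin a ⊕ μ) (Fin n ⊕ Fin d) ℝ → Matrix (Fin n) (Fin d) ℝ}
    (hL : ∀ Δ, ∃ k,
      h.IsTangent Δ (fromRows (L Δ) (0 : Matrix (Fin d) (Fin d) ℝ) * h.V2.toRows₂) k) :
    IsLeast {c | 0 ≤ c ∧ ∀ Δ, ‖L Δ‖ ≤ c * ‖Δ‖} (specNorm (Hr h.V2.toRows₂ (W1 hn h.Vs h.V1) *
      Gr hn (block hn (diagonal h.s) 0 0 (diagonal h.σ1)) (diagonal h.σ2) *
      Zr hn D.toRows₂ h.pinvS h.Us h.U1 h.U2)) := by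
  let e := (blockEquiv hn).symm
  have hTT : (h.T.submatrix id e)ᵀ * h.T.submatrix id e = 1 :=
    (congrArg (·.submatrix e e) h.T_transpose_mul_T).trans (submatrix_one_equiv e)
  have hWW : (h.W.submatrix id e)ᵀ * h.W.submatrix id e = 1 :=
    (congrArg (·.submatrix e e) h.W_transpose_mul_W).trans (submatrix_one_equiv e)
  have hWV0 : (h.W.submatrix id e)ᵀ * h.V2 = 0 :=
    congrArg (·.submatrix e id) h.W_transpose_mul_V2
  have hWV : h.W.submatrix id e * (h.W.submatrix id e)ᵀ + h.V2 * h.V2ᵀ = 1 := by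
    rw [transpose_submatrix, submatrix_mul_equiv, submatrix_id_id, h.W_mul_transpose]
  refine RBTLSE.isLeast_specNorm (fun Δ => ?_) (norm_coords_le hTT hWV)
    (exists_coords_eq hTT hWV hWW hWV0 h.V2_V2)
  obtain ⟨k, hk⟩ := hL Δ
  rw [hk.mulVec_coords hn, norm_toLp_vec]
  rfl

/-! ### Condition numbers -/

section NormedSpace

variable {E G : Type*} [NormedAddCommGroup E] [NormedSpace ℝ E] [NormedAddCommGroup G]
  [NormedSpace ℝ G] {φ : E → G} {L : E →L[ℝ] G} {x₀ : E}

theorem eventually_norm_sub_sub_le (hφ : HasFDerivAt φ L x₀) {η : ℝ} (hη : 0 < η) :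
    ∀ᶠ r in 𝓝[>] (0 : ℝ), ∀ Δ : E, ‖Δ‖ ≤ r → ‖φ (x₀ + Δ) - φ x₀ - L Δ‖ ≤ η * r := by
  obtain ⟨δ, hδ, hball⟩ :=
    Metric.eventually_nhds_iff.1 ((hasFDerivAt_iff_isLittleO_nhds_zero.1 hφ).def hη)
  filter_upwards [Ioo_mem_nhdsGT hδ] with r hr Δ hΔ
  have hle := hball (y := Δ) (by simpa using hΔ.trans_lt hr.2)
  exact hle.trans (mul_le_mul_of_nonneg_left hΔ hη.le)

/-- The relative sizes of the changes of `φ` under changes of `x₀` of norm at most `r`. -/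
def relChanges (φ : E → G) (x₀ : E) (r : ℝ) : Set ℝ :=
  {y | ∃ Δ, ‖Δ‖ ≤ r ∧ y = ‖φ x₀ - φ (x₀ + Δ)‖ / r}

theorem eventually_relChanges_le (hφ : HasFDerivAt φ L x₀) {c : ℝ} (hc : ‖L‖ < c) :
    ∀ᶠ r in 𝓝[>] (0 : ℝ), ∀ y ∈ relChanges φ x₀ r, y ≤ c := by
  filter_upwards [eventually_norm_sub_sub_le hφ (sub_pos.2 hc), self_mem_nhdsWithin]
    with r happrox (hr : 0 < r)
  rintro y ⟨Δ, hΔ, rfl⟩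
  rw [div_le_iff₀ hr, norm_sub_rev]
  calc ‖φ (x₀ + Δ) - φ x₀‖ ≤ ‖L Δ‖ + ‖φ (x₀ + Δ) - φ x₀ - L Δ‖ := norm_le_norm_add_norm_sub' _ _
    _ ≤ ‖L‖ * r + (c - ‖L‖) * r := add_le_add (L.le_opNorm_of_le hΔ) (happrox Δ hΔ)
    _ = c * r := by ring

theorem eventually_exists_lt_relChanges (hφ : HasFDerivAt φ L x₀) {c : ℝ} (hc : c < ‖L‖) :
    ∀ᶠ r in 𝓝[>] (0 : ℝ), ∃ y ∈ relChanges φ x₀ r, c < y := by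
  obtain ⟨x, hx, hcx⟩ := L.exists_lt_apply_of_lt_opNorm hc
  obtain ⟨c', hcc', hc'x⟩ := exists_between hcx
  filter_upwards [eventually_norm_sub_sub_le hφ (sub_pos.2 hc'x), self_mem_nhdsWithin]
    with r happrox (hr : 0 < r)
  have hrx : ‖r • x‖ ≤ r := by
    rw [norm_smul, Real.norm_of_nonneg hr.le]
    exact mul_le_of_le_one_right hr.le hx.le
  refine ⟨_, ⟨r • x, hrx, rfl⟩, hcc'.trans_le ?_⟩
  rw [le_div_iff₀ hr, norm_sub_rev]
  calc c' * r = ‖L (r • x)‖ - (‖L x‖ - c') * r := by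
        rw [map_smul, norm_smul, Real.norm_of_nonneg hr.le]
        ring
    _ ≤ ‖L (r • x)‖ - ‖φ (x₀ + r • x) - φ x₀ - L (r • x)‖ := sub_le_sub_left (happrox _ hrx) _
    _ ≤ ‖φ (x₀ + r • x) - φ x₀‖ := by
        rw [norm_sub_rev _ (L (r • x)), sub_le_iff_le_add]
        exact norm_le_norm_add_norm_sub' _ _

theorem exists_isLUB_relChanges_tendsto (hφ : HasFDerivAt φ L x₀) :
    ∃ s : ℝ → ℝ, (∀ᶠ r in 𝓝[>] (0 : ℝ), IsLUB (relChanges φ x₀ r) (s r)) ∧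
      Tendsto s (𝓝[>] (0 : ℝ)) (𝓝 ‖L‖) := by
  have hLUB : ∀ᶠ r in 𝓝[>] (0 : ℝ), IsLUB (relChanges φ x₀ r) (sSup (relChanges φ x₀ r)) := by
    filter_upwards [eventually_relChanges_le hφ (lt_add_one ‖L‖), self_mem_nhdsWithin]
      with r hle (hr : 0 < r)
    exact isLUB_csSup ⟨_, 0, by simpa using hr.le, rfl⟩ ⟨_, hle⟩
  refine ⟨_, hLUB, tendsto_order.2 ⟨fun c hc => ?_, fun c hc => ?_⟩⟩
  · filter_upwards [hLUB, eventually_exists_lt_relChanges hφ hc] with r hr ⟨y, hy, hcy⟩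
    exact hcy.trans_le (hr.1 hy)
  · obtain ⟨c', hLc', hc'c⟩ := exists_between hc
    filter_upwards [hLUB, eventually_relChanges_le hφ hLc'] with r hr hle
    exact (hr.2 hle).trans_lt hc'c

end NormedSpace

section RealSolution

open scoped Matrix.Norms.Frobenius

variable {m n d p : ℕ} {A : Matrix (Fin m) (Fin n) RBQ} {B : Matrix (Fin m) (Fin d) RBQ}
  {C : Matrix (Fin p) (Fin n) RBQ} {D : Matrix (Fin p) (Fin d) RBQ}
  {φ : Matrix (Fin (4 * p) ⊕ Fin (4 * m)) (Fin n ⊕ Fin d) ℝ → Matrix (Fin n) (Fin d) ℝ}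

theorem exists_forall_isRealSolution_iff
    (hsol : ∀ᶠ M in 𝓝 (realData A B C D), ∀ X, IsTLSESol M X ↔ X = φ M) :
    ∃ δ > 0, ∀ ΔA ΔB ΔC ΔD, dataNorm ΔA ΔB ΔC ΔD < δ → ∀ X,
      IsRealSolution (A + ΔA) (B + ΔB) (C + ΔC) (D + ΔD) X ↔
        X = φ (realData A B C D + realData ΔA ΔB ΔC ΔD) := by
  obtain ⟨δ, hδ, hball⟩ := Metric.eventually_nhds_iff.1 hsol
  refine ⟨δ, hδ, fun ΔA ΔB ΔC ΔD hΔ X => ?_⟩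
  rw [isRealSolution_iff, realData_add]
  refine hball ?_ X
  rwa [dist_eq_norm, add_sub_cancel_left, ← frob, ← dataNorm_eq_frob_realData]

theorem locallyUniquelySolvable_of_eventually
    (hsol : ∀ᶠ M in 𝓝 (realData A B C D), ∀ X, IsTLSESol M X ↔ X = φ M) :
    LocallyUniquelySolvable A B C D := by
  obtain ⟨δ, hδ, hiff⟩ := exists_forall_isRealSolution_iff hsol
  obtain ⟨ε, hε, hεδ⟩ := exists_pos_mul_lt hδ (dataNorm A B C D)
  refine ⟨ε, hε, fun ΔA ΔB ΔC ΔD hΔ => ?_⟩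
  have hΔδ := hΔ.trans_lt ((mul_comm _ _).trans_lt hεδ)
  exact ⟨_, (hiff ΔA ΔB ΔC ΔD hΔδ _).2 rfl, fun X hX => (hiff ΔA ΔB ΔC ΔD hΔδ X).1 hX⟩

theorem eventually_relErrors_eq_image
    (hsol : ∀ᶠ M in 𝓝 (realData A B C D), ∀ X, IsTLSESol M X ↔ X = φ M)
    (hD : 0 < dataNorm A B C D) :
    ∀ᶠ ε in 𝓝[>] (0 : ℝ), relErrors A B C D (φ (realData A B C D)) ε =
      (fun y => y * (dataNorm A B C D / frob (φ (realData A B C D)))) ''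
        relChanges φ (realData A B C D) (ε * dataNorm A B C D) := by
  obtain ⟨δ, hδ, hiff⟩ := exists_forall_isRealSolution_iff hsol
  filter_upwards [Ioo_mem_nhdsGT (div_pos hδ hD)] with ε hε
  have hscale (M : Matrix (Fin (4 * p) ⊕ Fin (4 * m)) (Fin n ⊕ Fin d) ℝ) :
      ‖φ (realData A B C D) - φ M‖ / (ε * dataNorm A B C D) *
          (dataNorm A B C D / frob (φ (realData A B C D))) =
        frob (φ (realData A B C D) - φ M) / (ε * frob (φ (realData A B C D))) := by
    rw [div_mul_div_comm, mul_comm ε, mul_assoc, mul_comm (‖_‖), mul_div_mul_left _ _ hD.ne']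
    rfl
  have hεδ : ε * dataNorm A B C D < δ := (lt_div_iff₀ hD).1 hε.2
  ext y
  constructor
  · rintro ⟨ΔA, ΔB, ΔC, ΔD, X, hΔ, hX, rfl⟩
    rw [(hiff _ _ _ _ (hΔ.trans_lt hεδ) X).1 hX, ← hscale]
    rw [dataNorm_eq_frob_realData ΔA] at hΔ
    exact ⟨_, ⟨_, hΔ, rfl⟩, rfl⟩
  · rintro ⟨_, ⟨Δ, hΔ, rfl⟩, rfl⟩
    obtain ⟨ΔA, ΔB, ΔC, ΔD, rfl⟩ := exists_realData_eq Δ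
    rw [← frob, ← dataNorm_eq_frob_realData] at hΔ
    exact ⟨ΔA, ΔB, ΔC, ΔD, _, hΔ, (hiff _ _ _ _ (hΔ.trans_lt hεδ) _).2 rfl, hscale _⟩

theorem hasRelCondNumber_of_hasFDerivAt
    {L : Matrix (Fin (4 * p) ⊕ Fin (4 * m)) (Fin n ⊕ Fin d) ℝ →L[ℝ] Matrix (Fin n) (Fin d) ℝ}
    (hφ : HasFDerivAt φ L (realData A B C D))
    (hsol : ∀ᶠ M in 𝓝 (realData A B C D), ∀ X, IsTLSESol M X ↔ X = φ M)
    (hD : 0 < dataNorm A B C D) {k : ℝ}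
    (hk : IsLeast {c | 0 ≤ c ∧ ∀ Δ, ‖L Δ‖ ≤ c * ‖Δ‖} k) :
    HasRelCondNumber A B C D (φ (realData A B C D))
      (k * (dataNorm A B C D / frob (φ (realData A B C D)))) := by
  obtain ⟨s, hs, hsL⟩ := exists_isLUB_relChanges_tendsto hφ
  rw [hk.unique (ContinuousLinearMap.isLeast_opNorm _)]
  have hscale : Tendsto (fun ε => ε * dataNorm A B C D) (𝓝[>] 0) (𝓝[>] 0) := by
    refine tendsto_nhdsWithin_iff.2 ⟨?_, ?_⟩
    · have h0 : Tendsto (fun ε => ε * dataNorm A B C D) (𝓝 0) (𝓝 0) :=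
        (continuous_mul_const _).tendsto' _ _ (zero_mul _)
      exact h0.mono_left nhdsWithin_le_nhds
    · filter_upwards [self_mem_nhdsWithin] with ε hε using mul_pos hε hD
  refine ⟨fun ε => s (ε * dataNorm A B C D) * _, ?_, (hsL.comp hscale).mul_const _⟩
  filter_upwards [eventually_relErrors_eq_image hsol hD, hscale.eventually hs] with ε hε hsε
  rw [hε]
  exact hsε.mul_right (div_nonneg hD.le (frob_nonneg _))

end RealSolution

/-! ### The adapted decomposition of the given data -/

theorem IsMoorePenrose.unique {ι κ : Type*} [Fintype ι] [Fintype κ] {M : Matrix ι κ ℝ}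
    {Y Y' : Matrix κ ι ℝ} (h : IsMoorePenrose M Y) (h' : IsMoorePenrose M Y') : Y = Y' := by
  have hMY : M * Y = M * Y' := by
    calc M * Y = M * Y' * (M * Y) := by rw [← Matrix.mul_assoc, h'.mul_mul]
      _ = (M * Y * (M * Y'))ᵀ := by rw [transpose_mul, h.left_symm, h'.left_symm]
      _ = M * Y' := by rw [← Matrix.mul_assoc, h.mul_mul, h'.left_symm]
  have hYM : Y * M = Y' * M := by
    calc Y * M = Y * M * (Y' * M) := by rw [Matrix.mul_assoc, ← Matrix.mul_assoc M, h'.mul_mul]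
      _ = (Y' * M * (Y * M))ᵀ := by rw [transpose_mul, h.right_symm, h'.right_symm]
      _ = Y' * M := by rw [Matrix.mul_assoc, ← Matrix.mul_assoc M, h.mul_mul, h'.right_symm]
  rw [← h.inv_mul_inv, hYM, Matrix.mul_assoc, hMY, ← Matrix.mul_assoc, h'.inv_mul_inv]

theorem orthonormal_and_mul_eq_zero_of_qr {κ ν α γ : Type*} [Fintype κ] [Fintype α] [DecidableEq α]
    [Fintype γ] [DecidableEq γ] {S : Matrix ν κ ℝ} {Q1 : Matrix κ α ℝ} {Q2 : Matrix κ γ ℝ}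
    {R : Matrix α ν ℝ} (hQ : (fromCols Q1 Q2)ᵀ * fromCols Q1 Q2 = 1)
    (hQR : Sᵀ = fromCols Q1 Q2 * fromRows R (0 : Matrix γ ν ℝ)) : Q2ᵀ * Q2 = 1 ∧ S * Q2 = 0 := by
  rw [transpose_fromCols, fromRows_mul_fromCols, ← fromBlocks_one, fromBlocks_inj] at hQ
  refine ⟨hQ.2.2.2, ?_⟩
  rw [← transpose_transpose S, hQR, fromCols_mul_fromRows, Matrix.mul_zero, add_zero,
    transpose_mul, Matrix.mul_assoc, hQ.2.1, Matrix.mul_zero]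

theorem linearIndependent_row_of_rank_eq {k n : ℕ} {M : Matrix (Fin k) (Fin n) ℝ}
    (hM : M.rank = k) : LinearIndependent ℝ M.row := by
  rw [linearIndependent_iff_card_eq_finrank_span, Fintype.card_fin, Set.finrank,
    ← rank_eq_finrank_span_row, hM]

theorem linearIndependent_row_fromCols {ι κ κ' : Type*} {M : Matrix ι κ ℝ} (N : Matrix ι κ' ℝ)
    (hM : LinearIndependent ℝ M.row) : LinearIndependent ℝ (fromCols M N).row :=
  .of_comp (LinearMap.funLeft ℝ ℝ Sum.inl) hM

theorem IsThinSVD.ne_zero {ι κ : Type*} [Fintype ι] [Fintype κ] {r : ℕ} {M : Matrix ι κ ℝ}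
    {U : Matrix ι (Fin r) ℝ} {σ : Fin r → ℝ} {V : Matrix κ (Fin r) ℝ} (h : IsThinSVD M U σ V)
    (hM : LinearIndependent ℝ M.row) (i : Fin r) : σ i ≠ 0 := by
  intro hσ
  have hUM : Uᵀ * M = diagonal σ * Vᵀ := by
    rw [h.eq, Matrix.mul_assoc, ← Matrix.mul_assoc Uᵀ, h.left_orthonormal, Matrix.one_mul]
  have hi : U.col i ᵥ* M = 0 := by
    change (Uᵀ * M).row i = 0
    rw [hUM]
    funext j
    simp [hσ]
  have hU : U.col i = 0 := vecMul_injective_iff.2 hM (hi.trans (zero_vecMul M).symm)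
  have hUU : U.col i ⬝ᵥ U.col i = 1 :=
    (congrFun (congrFun h.left_orthonormal i) i).trans (one_apply_eq i)
  rw [hU, zero_dotProduct] at hUU
  exact zero_ne_one hUU

section Columns

variable {κ : Type*} {a b : ℕ}

theorem transpose_mul_leftCols_rightCols [Fintype κ] {M : Matrix κ (Fin (a + b)) ℝ}
    (hM : Mᵀ * M = 1) :
    (leftCols M)ᵀ * leftCols M = 1 ∧ (leftCols M)ᵀ * rightCols M = 0 ∧
      (rightCols M)ᵀ * rightCols M = 1 := by
  have hcols : fromCols (leftCols M) (rightCols M) = M.submatrix id finSumFinEquiv := by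
    ext i (j | j) <;> rfl
  have horth : (M.submatrix id finSumFinEquiv)ᵀ * M.submatrix id finSumFinEquiv = 1 :=
    (congrArg (·.submatrix finSumFinEquiv finSumFinEquiv) hM).trans (submatrix_one_equiv _)
  rw [← hcols, transpose_fromCols, fromRows_mul_fromCols, ← fromBlocks_one, fromBlocks_inj] at horth
  exact ⟨horth.1, horth.2.1, horth.2.2.2⟩

theorem leftCols_mul_diagonal (M : Matrix κ (Fin (a + b)) ℝ) (σ : Fin (a + b) → ℝ) :
    leftCols (M * diagonal σ) = leftCols M * diagonal fun i => σ (Fin.castAdd b i) := by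
  ext i j
  simp [leftCols, mul_diagonal]

theorem rightCols_mul_diagonal (M : Matrix κ (Fin (a + b)) ℝ) (σ : Fin (a + b) → ℝ) :
    rightCols (M * diagonal σ) = rightCols M * diagonal fun i => σ (Fin.natAdd a i) := by
  ext i j
  simp [rightCols, mul_diagonal]

end Columns

namespace AdaptedSVD

/-- The decomposition obtained from a thin singular value decomposition of `S` and one of `P Q₂`,
where the columns of `Q₂` form an orthonormal basis of the kernel of `S`. -/
def ofThinSVD {k q d : ℕ} {μ ι : Type*} [Fintype μ] [Fintype ι]
    {D : Matrix (Fin k ⊕ μ) (ι ⊕ Fin d) ℝ} {Q2 : Matrix (ι ⊕ Fin d) (Fin (q + d)) ℝ}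
    {U : Matrix μ (Fin (q + d)) ℝ} {σ : Fin (q + d) → ℝ} {V : Matrix (Fin (q + d)) (Fin (q + d)) ℝ}
    {Us : Matrix (Fin k) (Fin k) ℝ} {s : Fin k → ℝ} {Vs : Matrix (ι ⊕ Fin d) (Fin k) ℝ}
    (hcard : Fintype.card ι = k + q) (hQ2 : Q2ᵀ * Q2 = 1) (hSQ2 : D.toRows₁ * Q2 = 0)
    (hP : IsThinSVD (D.toRows₂ * Q2) U σ V)
    (hgap : ∀ i j, σ (Fin.natAdd q j) < σ (Fin.castAdd d i))
    (hV22 : IsUnit (rightCols (Q2 * V)).toRows₂) (hS : IsThinSVD D.toRows₁ Us s Vs)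
    (hs : ∀ i, s i ≠ 0) : AdaptedSVD D (Fin q) :=
  have hQV : (Q2 * V)ᵀ * (Q2 * V) = 1 := by
    rw [transpose_mul, Matrix.mul_assoc, ← Matrix.mul_assoc Q2ᵀ, hQ2, Matrix.one_mul,
      hP.right_orthonormal]
  have hVs : Vsᵀ * (Q2 * V) = 0 := by
    rw [← diagonal_inv_mul_transpose_mul (V := Vs) hS.left_orthonormal hs, ← hS.eq,
      Matrix.mul_assoc, ← Matrix.mul_assoc D.toRows₁, hSQ2, Matrix.zero_mul, Matrix.mul_zero]
  have hPQV : D.toRows₂ * (Q2 * V) = U * diagonal σ := by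
    rw [← Matrix.mul_assoc, hP.eq, Matrix.mul_assoc, hP.right_orthonormal, Matrix.mul_one]
  have hV := transpose_mul_leftCols_rightCols hQV
  have hU := transpose_mul_leftCols_rightCols hP.left_orthonormal
  { Us := Us
    s := s
    Vs := Vs
    U1 := leftCols U
    σ1 := fun i => σ (Fin.castAdd d i)
    V1 := leftCols (Q2 * V)
    U2 := rightCols U
    σ2 := fun j => σ (Fin.natAdd q j)
    V2 := rightCols (Q2 * V)
    card_eq := by rw [hcard, Fintype.card_fin, Fintype.card_fin]
    Us_Us := hS.left_orthonormal
    s_ne := hs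
    Vs_Vs := hS.right_orthonormal
    Vs_V1 := congrArg leftCols hVs
    Vs_V2 := congrArg rightCols hVs
    V1_V1 := hV.1
    V1_V2 := hV.2.1
    V2_V2 := hV.2.2
    U1_U1 := hU.1
    U1_U2 := hU.2.1
    U2_U2 := hU.2.2
    S_eq := hS.eq
    P_V1 := (congrArg leftCols hPQV).trans (leftCols_mul_diagonal U σ)
    P_V2 := (congrArg rightCols hPQV).trans (rightCols_mul_diagonal U σ)
    nonneg := fun j => hP.nonneg _
    gap := hgap
    isUnit_V22 := hV22 }

theorem isMoorePenrose_pinvS {ν μ ι τ β : Type*} [Fintype ν] [DecidableEq ν] [Fintype μ]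
    [Fintype ι] [Fintype τ] [DecidableEq τ] [Fintype β] [DecidableEq β]
    {D : Matrix (ν ⊕ μ) (ι ⊕ τ) ℝ} (h : AdaptedSVD D β) : IsMoorePenrose D.toRows₁ h.pinvS := by
  have hYS : h.pinvS * D.toRows₁ = h.Vs * h.Vsᵀ := by
    rw [pinvS, Matrix.mul_assoc, h.normalizer_mul_S]
  have hSY : D.toRows₁ * h.pinvS = 1 := by
    have hinv : h.normalizer * (h.Us * diagonal h.s) = 1 := by
      simpa [normalizer] using
        diagonal_inv_mul_transpose_mul (V := (1 : Matrix ν ν ℝ)) h.Us_Us h.s_ne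
    rw [h.S_eq, pinvS, Matrix.mul_assoc, ← Matrix.mul_assoc h.Vsᵀ, h.Vs_Vs, Matrix.one_mul,
      mul_eq_one_comm.1 hinv]
  exact {
    mul_mul := by rw [hSY, Matrix.one_mul]
    inv_mul_inv := by rw [Matrix.mul_assoc, hSY, Matrix.mul_one]
    left_symm := by rw [hSY, transpose_one]
    right_symm := by rw [hYS, transpose_mul, transpose_transpose] }

end AdaptedSVD

theorem isTLSESol_zero {ν μ ι τ : Type*} [Fintype μ] [Fintype ι] [Fintype τ] [DecidableEq τ] :
    IsTLSESol (0 : Matrix (ν ⊕ μ) (ι ⊕ τ) ℝ) 0 := by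
  have hS : (0 : Matrix (ν ⊕ μ) (ι ⊕ τ) ℝ).toRows₁ = 0 := rfl
  have hP : (0 : Matrix (ν ⊕ μ) (ι ⊕ τ) ℝ).toRows₂ = 0 := rfl
  refine ⟨by rw [hS, Matrix.zero_mul], 0, by rw [hP, add_zero, Matrix.zero_mul], fun _ E _ _ => ?_⟩
  simpa [frob_eq_sqrt 0] using frob_nonneg E

open scoped Matrix.Norms.Frobenius in
theorem dataNorm_pos {m n d p : ℕ} {A : Matrix (Fin m) (Fin n) RBQ}
    {B : Matrix (Fin m) (Fin d) RBQ} {C : Matrix (Fin p) (Fin n) RBQ}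
    {D : Matrix (Fin p) (Fin d) RBQ} {X : Matrix (Fin n) (Fin d) ℝ}
    (hsol : ∀ Y, IsTLSESol (realData A B C D) Y → Y = X) (hX : X ≠ 0) :
    0 < dataNorm A B C D := by
  rw [dataNorm_eq_frob_realData]
  refine norm_pos_iff.2 fun h0 => hX (hsol 0 ?_).symm
  rw [h0]
  exact isTLSESol_zero

end RBTLSE

theorem theorem5p1_general {m n d p q : ℕ}
    (A : Matrix (Fin m) (Fin n) RBQ) (B : Matrix (Fin m) (Fin d) RBQ)
    (C : Matrix (Fin p) (Fin n) RBQ) (D : Matrix (Fin p) (Fin d) RBQ)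
    (hq : n = 4 * p + q) (hC : (RBTLSE.realCol C).rank = 4 * p)
    (P : Matrix (Fin (4 * m)) (Fin n ⊕ Fin d) ℝ)
    (hP : P = fromCols (RBTLSE.realCol A) (RBTLSE.realCol B))
    (S : Matrix (Fin (4 * p)) (Fin n ⊕ Fin d) ℝ)
    (hS : S = fromCols (RBTLSE.realCol C) (RBTLSE.realCol D))
    (Q2 : Matrix (Fin n ⊕ Fin d) (Fin (q + d)) ℝ) (hQ2 : Q2ᵀ * Q2 = 1) (hSQ2 : S * Q2 = 0)
    (U : Matrix (Fin (4 * m)) (Fin (q + d)) ℝ) (σ : Fin (q + d) → ℝ)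
    (V : Matrix (Fin (q + d)) (Fin (q + d)) ℝ) (hsvd : RBTLSE.IsThinSVD (P * Q2) U σ V)
    (hgap : ∀ (i : Fin q) (j : Fin d), σ (Fin.natAdd q j) < σ (Fin.castAdd d i))
    (hV22 : IsUnit (RBTLSE.rightCols (Q2 * V)).toRows₂)
    (Us : Matrix (Fin (4 * p)) (Fin (4 * p)) ℝ) (s : Fin (4 * p) → ℝ)
    (Vs : Matrix (Fin n ⊕ Fin d) (Fin (4 * p)) ℝ) (hsvdS : RBTLSE.IsThinSVD S Us s Vs)
    (Sdag : Matrix (Fin n ⊕ Fin d) (Fin (4 * p)) ℝ) (hSdag : RBTLSE.IsMoorePenrose S Sdag)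
    (X : Matrix (Fin n) (Fin d) ℝ) (hX : RBTLSE.IsRealSolution A B C D X) (hX0 : X ≠ 0) :
    RBTLSE.LocallyUniquelySolvable A B C D ∧
    RBTLSE.HasRelCondNumber A B C D X
      (RBTLSE.specNorm
          (RBTLSE.Hr (RBTLSE.rightCols (Q2 * V)).toRows₂
              (RBTLSE.W1 hq Vs (RBTLSE.leftCols (Q2 * V))) *
            RBTLSE.Gr hq (RBTLSE.block hq (diagonal s) 0 0 (diagonal fun i => σ (Fin.castAdd d i)))
              (diagonal fun j => σ (Fin.natAdd q j)) *
            RBTLSE.Zr hq P Sdag Us (RBTLSE.leftCols U) (RBTLSE.rightCols U)) *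
        RBTLSE.dataNorm A B C D / RBTLSE.frob X) := by
  subst hP hS
  have hs := hsvdS.ne_zero
    (RBTLSE.linearIndependent_row_fromCols _ (RBTLSE.linearIndependent_row_of_rank_eq hC))
  let h : RBTLSE.AdaptedSVD (RBTLSE.realData A B C D) (Fin q) :=
    .ofThinSVD ((Fintype.card_fin n).trans hq) hQ2 hSQ2 hsvd hgap hV22 hsvdS hs
  obtain ⟨φ, L, hφ, hsol, hL⟩ := h.exists_solution_map
  obtain rfl : X = φ (RBTLSE.realData A B C D) :=
    (hsol.self_of_nhds X).1 ((RBTLSE.isRealSolution_iff A B C D X).1 hX)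
  obtain rfl : Sdag = h.pinvS := hSdag.unique h.isMoorePenrose_pinvS
  have hD : 0 < RBTLSE.dataNorm A B C D :=
    RBTLSE.dataNorm_pos (fun Y => (hsol.self_of_nhds Y).1) hX0
  rw [mul_div_assoc]
  exact ⟨RBTLSE.locallyUniquelySolvable_of_eventually hsol,
    RBTLSE.hasRelCondNumber_of_hasFDerivAt hφ hsol hD (h.isLeast_specNorm hq hL)⟩

theorem theorem5p1 {m n d p q : ℕ}
    (A : Matrix (Fin m) (Fin n) RBQ) (B : Matrix (Fin m) (Fin d) RBQ)
    (C : Matrix (Fin p) (Fin n) RBQ) (D : Matrix (Fin p) (Fin d) RBQ)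
    -- `q` is `n - 4p`; the rank condition on `C` already forces `4p ≤ n`
    (hq : n = 4 * p + q) (hm : n + d ≤ m)
    (hC : (RBTLSE.realCol C).rank = 4 * p)
    (P : Matrix (Fin (4 * m)) (Fin n ⊕ Fin d) ℝ)
    (hP : P = fromCols (RBTLSE.realCol A) (RBTLSE.realCol B))
    (S : Matrix (Fin (4 * p)) (Fin n ⊕ Fin d) ℝ)
    (hS : S = fromCols (RBTLSE.realCol C) (RBTLSE.realCol D))
    -- QR factorization of `Sᵀ`
    (Q1 : Matrix (Fin n ⊕ Fin d) (Fin (4 * p)) ℝ)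
    (Q2 : Matrix (Fin n ⊕ Fin d) (Fin (q + d)) ℝ)
    (R : Matrix (Fin (4 * p)) (Fin (4 * p)) ℝ)
    (hQ : (fromCols Q1 Q2)ᵀ * fromCols Q1 Q2 = 1)
    (hQ' : fromCols Q1 Q2 * (fromCols Q1 Q2)ᵀ = 1)
    (hR : R.BlockTriangular id)
    (hQR : Sᵀ = fromCols Q1 Q2 * fromRows R (0 : Matrix (Fin (q + d)) (Fin (4 * p)) ℝ))
    -- thin SVD of `P Q2`
    (U : Matrix (Fin (4 * m)) (Fin (q + d)) ℝ) (σ : Fin (q + d) → ℝ)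
    (V : Matrix (Fin (q + d)) (Fin (q + d)) ℝ)
    (hsvd : RBTLSE.IsThinSVD (P * Q2) U σ V)
    (hσ : ∀ i, 0 < σ i)
    (hgap : ∀ (i : Fin q) (j : Fin d), σ (Fin.natAdd q j) < σ (Fin.castAdd d i))
    (U1 : Matrix (Fin (4 * m)) (Fin q) ℝ) (hU1 : U1 = RBTLSE.leftCols U)
    (U2 : Matrix (Fin (4 * m)) (Fin d) ℝ) (hU2 : U2 = RBTLSE.rightCols U)
    (Sig1 : Matrix (Fin q) (Fin q) ℝ) (hSig1 : Sig1 = diagonal fun i => σ (Fin.castAdd d i))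
    (Sig2 : Matrix (Fin d) (Fin d) ℝ) (hSig2 : Sig2 = diagonal fun j => σ (Fin.natAdd q j))
    (V1 : Matrix (Fin n ⊕ Fin d) (Fin q) ℝ) (hV1 : V1 = RBTLSE.leftCols (Q2 * V))
    (V22 : Matrix (Fin d) (Fin d) ℝ)
    (hV22 : V22 = (RBTLSE.rightCols (Q2 * V)).submatrix Sum.inr id)
    (hV22_unit : IsUnit V22)
    -- skinny SVD of `S`
    (Us : Matrix (Fin (4 * p)) (Fin (4 * p)) ℝ) (s : Fin (4 * p) → ℝ)
    (Vs : Matrix (Fin n ⊕ Fin d) (Fin (4 * p)) ℝ)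
    (hsvdS : RBTLSE.IsThinSVD S Us s Vs)
    (Sdag : Matrix (Fin n ⊕ Fin d) (Fin (4 * p)) ℝ)
    (hSdag : RBTLSE.IsMoorePenrose S Sdag)
    (Sr : Matrix (Fin n) (Fin n) ℝ)
    (hSr : Sr = RBTLSE.block hq (diagonal s) 0 0 Sig1)
    (Jr : Matrix (Fin (4 * p) ⊕ Fin (4 * m)) (Fin n) ℝ)
    (hJr : Jr = fromRows (RBTLSE.realCol C) (RBTLSE.realCol A))
    (Kr : Matrix (Fin (4 * p) ⊕ Fin (4 * m)) (Fin d) ℝ)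
    (hKr : Kr = fromRows (RBTLSE.realCol D) (RBTLSE.realCol B))
    -- the real solution; its relative error makes sense only if it is nonzero
    (X : Matrix (Fin n) (Fin d) ℝ)
    (hX : RBTLSE.IsRealSolution A B C D X) (hX0 : X ≠ 0) :
    RBTLSE.LocallyUniquelySolvable A B C D ∧
    RBTLSE.HasRelCondNumber A B C D X
      (RBTLSE.specNorm
          (RBTLSE.Hr V22 (RBTLSE.W1 hq Vs V1) * RBTLSE.Gr hq Sr Sig2 *
            RBTLSE.Zr hq P Sdag Us U1 U2) *
        RBTLSE.frob (fromCols Jr Kr) / RBTLSE.frob X) := by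
  subst hU1 hU2 hSig1 hSig2 hV1 hV22 hSr hJr hKr
  obtain ⟨hQ2, hSQ2⟩ := RBTLSE.orthonormal_and_mul_eq_zero_of_qr hQ hQR
  rw [← RBTLSE.dataNorm_eq_frob_fromCols]
  exact theorem5p1_general A B C D hq hC P hP S hS Q2 hQ2 hSQ2 U σ V hsvd hgap hV22_unit
    Us s Vs hsvdS Sdag hSdag X hX hX0
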